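/- Let $m>0$, $\omega_{\mathbf p}=\sqrt{|\mathbf p|^2+m^2}$ for $\mathbf p\in\mathbb R^3$, and $d\mu(\mathbf p)=d^3\mathbf p/(2\omega_{\mathbf p})$. For $x=(x^0,\mathbf x)\in\mathbb R\times\mathbb R^3$ write $p\cdot x=\omega_{\mathbf p}x^0-\mathbf p\cdot\mathbf x$. Let $\mathscr F=\bigoplus_{k\ge 0}\mathscr H_k^+$ be the bosonic Fock space, where $\mathscr H_k^+$ is the space of symmetric functions in $L^2((\mathbb R^3)^k,d\mu^{\otimes k})$. For measurable $c:\mathbb R^3\to\mathbb C$ let $\int d\mu(\mathbf p)\,c(\mathbf p)\,a_c(\mathbf p)$ be the operator $$\Psi\mapsto\Phi,\qquad \Phi_k(\mathbf p_1,\dots,\mathbf p_k)=\sqrt{k+1}\int d\mu(\mathbf p)\,c(\mathbf p)\,\Psi_{k+1}(\mathbf p,\mathbf p_1,\dots,\mathbf p_k),$$ on the maximal domain of all $\Psi\in\mathscr F$ for which, for every $k$, these integrals converge absolutely almost everywhere and $\Phi\in\mathscr F$. Put $a(\mathbf p)=a_c(\mathbf p)/\sqrt{2\omega_{\mathbf p}}$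 and $$\phi_1(x)=\int d\mu(\mathbf p)\,\overline{\Psi_x(\mathbf p)}\,a_c(\mathbf p),\quad \Psi_x(\mathbf p)=(2\pi)^{-3/2}e^{ip\cdot x}(2\omega_{\mathbf p})^{1/2},\qquad \tilde a(\mathbf x)=(2\pi)^{-3/2}\int d^3\mathbf p\,e^{i\mathbf p\cdot\mathbf x}a(\mathbf p).$$ For $y=(y^0,\mathbf y)\in\mathbb R^4$ and $R\in SO(3)$, with $\Lambda_R=\mathrm{diag}(1,R)$, let $U(y,\Lambda_R)$ be the unitary operator on $\mathscr F$ given by $$(U(y,\Lambda_R)\Psi)_k(\mathbf p_1,\dots,\mathbf p_k)=e^{i(p_1+\cdots+p_k)\cdot y}\,\Psi_k(R^{-1}\mathbf p_1,\dots,R^{-1}\mathbf p_k).$$ Let $\mathscr D$ be the set of vectors in $\mathscr F$ with finitely many nonzero components, all of which are (a.e. equal to) Schwartz functions. For complex $t$ and $\mathbf v\in\mathbb R^3$ put $$\mathcal K_t(\mathbf v)=\frac{it}{2\pi^2}\,\frac{m^2K_2\!\left(m\sqrt{|\mathbf v|^2-t^2}\right)}{|\mathbf v|^2-t^2},$$ with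 the principal square root and the modified Bessel function $K_2(w)=\int_0^\infty e^{-w\cosh s}\cosh(2s)\,ds$, $\operatorname{Re}w>0$. **Theorem.** For all $y\in\mathbb R^4$ and $R\in SO(3)$: 1. For every $x=(x_0,\mathbf x)\in\mathbb R^4$, $\mathscr D$ is contained in the domain of $\phi_1(x)$, and $$U(y,\Lambda_R)\,\phi_1(x)\,U(y,\Lambda_R)^{-1}=\phi_1(x_0+y_0,\,R\mathbf x+\mathbf y)$$ as an equality of unbounded operators, including their domains. 2. For every $\mathbf x\in\mathbb R^3$, $$U(y,\Lambda_R)\,\tilde a(\mathbf x)\,U(y,\Lambda_R)^{-1}=\left(\mathcal K_{y^0-i0}\ast\tilde a\right)(R\mathbf x+\mathbf y)$$ on $\mathscr D$. That is, every $\Psi\in\mathscr D$ lies in the domain of the left-hand side and of every $\tilde a(\mathbf z)$, $\mathbf z\in\mathbb R^3$; for every $\varepsilon>0$ the function $\mathbf z\mapsto\mathcal K_{y^0-i\varepsilon}(R\mathbf x+\mathbf y-\mathbf z)\,\tilde a(\mathbf z)\Psi$ is Bochner integrable; and, in the norm of $\mathscr F$, $$U(y,\Lambda_R)\,\tilde a(\mathbf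 x)\,U(y,\Lambda_R)^{-1}\Psi=\lim_{\varepsilon\to0^+}\int d^3\mathbf z\;\mathcal K_{y^0-i\varepsilon}(R\mathbf x+\mathbf y-\mathbf z)\,\tilde a(\mathbf z)\Psi .$$ In the space-like region $|\mathbf v|>|y^0|$, $\mathcal K_{y^0-i\varepsilon}(\mathbf v)$ converges, locally uniformly in $\mathbf v$ as $\varepsilon\to0^+$, to $$\mathcal K_{y^0}(\mathbf v)=\frac{iy^0}{2\pi^2}\,\frac{m^2K_2\!\left(m\sqrt{|\mathbf v|^2-(y^0)^2}\right)}{|\mathbf v|^2-(y^0)^2}.$$ -/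

import Mathlib

open MeasureTheory Filter Topology Real

noncomputable section

namespace ScalarField

/-- Momentum space, and also coordinate space, for space dimension three. -/
abbrev E3 : Type := EuclideanSpace ℝ (Fin 3)

/-- Points `x = (x⁰, 𝐱)` of four-dimensional Minkowski space-time. -/
abbrev SpaceTime : Type := ℝ × E3

/-- The relativistic energy `ω_𝐩 = √(𝐩² + m²)`. -/
def omega (m : ℝ) (p : E3) : ℝ := √(‖p‖ ^ 2 + m ^ 2)

/-- The Lorentz-invariant measure `d³𝐩 / (2 ω_𝐩)` on the mass shell, parametrized by `𝐩`. -/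
def shellMeasure (m : ℝ) : Measure E3 :=
  (volume : Measure E3).withDensity (fun p => ENNReal.ofReal (1 / (2 * omega m p)))

/-- The Minkowski product `p · x = ω_𝐩 x⁰ - 𝐩 · 𝐱` of the on-shell four-momentum
`p = (ω_𝐩, 𝐩)` with a space-time point. -/
def shellDot (m : ℝ) (p : E3) (x : SpaceTime) : ℝ := omega m p * x.1 - inner ℝ p x.2

/-- The product measure on `k`-tuples of momenta. -/
abbrev shellMeasurePi (m : ℝ) (k : ℕ) : Measure (Fin k → E3) :=
  Measure.pi (fun _ : Fin k => shellMeasure m)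

instance (m : ℝ) : SigmaFinite (shellMeasure m) := by
  unfold shellMeasure; infer_instance

theorem continuous_omega (m : ℝ) : Continuous (omega m) := by
  unfold omega; fun_prop

theorem continuous_shellDot (m : ℝ) (x : SpaceTime) : Continuous (fun p => shellDot m p x) := by
  unfold shellDot
  have := continuous_omega m
  fun_prop

theorem measurePreserving_perm (m : ℝ) {k : ℕ} (σ : Equiv.Perm (Fin k)) :
    MeasurePreserving (fun p : Fin k → E3 => p ∘ σ) (shellMeasurePi m k) (shellMeasurePi m k) := by
  have h := measurePreserving_piCongrLeft (fun _ : Fin k => shellMeasure m) σ.symm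
  convert h using 1
  ext p i
  simp [MeasurableEquiv.coe_piCongrLeft, Equiv.piCongrLeft, Equiv.piCongrLeft']

/-- The symmetric `k`-particle space `ℋ_k⁺`: square-integrable functions of `k` momenta that are
invariant under all permutations of their arguments. For `k = 0` this is `ℂ`. -/
def symmSpace (m : ℝ) (k : ℕ) : Submodule ℂ (Lp ℂ 2 (shellMeasurePi m k)) where
  carrier := {f | ∀ σ : Equiv.Perm (Fin k),
    (fun p : Fin k → E3 => f (p ∘ σ)) =ᵐ[shellMeasurePi m k] f}
  zero_mem' := by
    intro σ
    have h0 := Lp.coeFn_zero ℂ 2 (shellMeasurePi m k)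
    have h1 := (measurePreserving_perm m σ).quasiMeasurePreserving.ae h0
    filter_upwards [h0, h1] with p hp hp'
    rw [hp, hp']; rfl
  add_mem' := by
    intro f g hf hg σ
    have h0 := Lp.coeFn_add f g
    have h1 := (measurePreserving_perm m σ).quasiMeasurePreserving.ae h0
    filter_upwards [h0, h1, hf σ, hg σ] with p hp hp' hfp hgp
    rw [hp, hp', Pi.add_apply, Pi.add_apply, hfp, hgp]
  smul_mem' := by
    intro c f hf σ
    have h0 := Lp.coeFn_smul c f
    have h1 := (measurePreserving_perm m σ).quasiMeasurePreserving.ae h0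
    filter_upwards [h0, h1, hf σ] with p hp hp' hfp
    rw [hp, hp', Pi.smul_apply, Pi.smul_apply, hfp]

theorem isClosed_symmSpace (m : ℝ) (k : ℕ) :
    IsClosed (symmSpace m k : Set (Lp ℂ 2 (shellMeasurePi m k))) := by
  have h : (symmSpace m k : Set (Lp ℂ 2 (shellMeasurePi m k))) =
      ⋂ σ : Equiv.Perm (Fin k),
        {f | Lp.compMeasurePreserving _ (measurePreserving_perm m σ) f = f} := by
    ext f
    simp only [Set.mem_iInter, Set.mem_ofPred_eq]
    refine forall_congr' fun σ => ?_
    have h1 := Lp.coeFn_compMeasurePreserving f (measurePreserving_perm m σ)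
    constructor
    · intro h
      exact Lp.ext (h1.trans h)
    · intro h
      rw [h] at h1
      exact h1.symm
  rw [h]
  refine isClosed_iInter fun σ => isClosed_eq ?_ continuous_id
  exact (Lp.isometry_compMeasurePreserving (measurePreserving_perm m σ)).continuous

instance (m : ℝ) (k : ℕ) : CompleteSpace (symmSpace m k) :=
  (isClosed_symmSpace m k).completeSpace_coe

/-- The bosonic Fock space: the Hilbert sum of the symmetric `k`-particle spaces. -/
abbrev Fock (m : ℝ) : Type := lp (fun k : ℕ => symmSpace m k) 2

/-- The `k`-particle wave function of a Fock vector. -/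
def Fock.wave {m : ℝ} (Ψ : Fock m) (k : ℕ) : (Fin k → E3) → ℂ :=
  ((Ψ k : symmSpace m k) : Lp ℂ 2 (shellMeasurePi m k))

theorem Fock.wave_add {m : ℝ} (Ψ Φ : Fock m) (k : ℕ) :
    (Ψ + Φ).wave k =ᵐ[shellMeasurePi m k] Ψ.wave k + Φ.wave k :=
  Lp.coeFn_add _ _

theorem Fock.wave_smul {m : ℝ} (c : ℂ) (Ψ : Fock m) (k : ℕ) :
    (c • Ψ).wave k =ᵐ[shellMeasurePi m k] c • Ψ.wave k :=
  Lp.coeFn_smul _ _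

theorem Fock.wave_zero (m : ℝ) (k : ℕ) :
    (0 : Fock m).wave k =ᵐ[shellMeasurePi m k] 0 :=
  Lp.coeFn_zero _ _ _

theorem ae_ae_cons (m : ℝ) {k : ℕ} {Q : (Fin (k + 1) → E3) → Prop}
    (h : ∀ᵐ p ∂(shellMeasurePi m (k + 1)), Q p) :
    ∀ᵐ q ∂(shellMeasurePi m k), ∀ᵐ p ∂(shellMeasure m), Q (Fin.cons p q) := by
  have h1 := (measurePreserving_piFinSuccAbove (fun _ : Fin (k + 1) => shellMeasure m) 0).symm
  have h2 := h1.quasiMeasurePreserving.ae h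
  have h3 := (Measure.measurePreserving_swap (μ := shellMeasurePi m k)
    (ν := shellMeasure m)).quasiMeasurePreserving.ae h2
  have h4 := Measure.ae_ae_of_ae_prod h3
  filter_upwards [h4] with q hq
  filter_upwards [hq] with p hp
  simpa [MeasurableEquiv.piFinSuccAbove, Fin.insertNthEquiv] using hp

/-- The graph of the operator `∫ d³𝐩/(2ω_𝐩) c(𝐩) a_c(𝐩)`, where `a_c(𝐩)` is the covariant
annihilation operator with sharp momentum. It sends `Ψ` to the Fock vector `Φ` with
`Φ_k(𝐩₁,…,𝐩_k) = √(k+1) ∫ d³𝐩/(2ω_𝐩) c(𝐩) Ψ_{k+1}(𝐩,𝐩₁,…,𝐩_k)`,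
whenever these integrals converge and define a Fock vector. -/
def annihilationGraph (m : ℝ) (c : E3 → ℂ) : Submodule ℂ (Fock m × Fock m) where
  carrier := {X | ∀ k : ℕ, ∀ᵐ q ∂(shellMeasurePi m k),
    Integrable (fun p => c p * X.1.wave (k + 1) (Fin.cons p q)) (shellMeasure m) ∧
    X.2.wave k q = (√((k : ℝ) + 1) : ℂ) *
      ∫ p, c p * X.1.wave (k + 1) (Fin.cons p q) ∂(shellMeasure m)}
  zero_mem' := by
    intro k
    filter_upwards [ae_ae_cons m (Fock.wave_zero m (k + 1)), Fock.wave_zero m k] with q h1 h2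
    have h3 : (fun p => c p * (0 : Fock m).wave (k + 1) (Fin.cons p q))
        =ᵐ[shellMeasure m] fun _ => 0 := by
      filter_upwards [h1] with p hp
      rw [hp]; simp
    refine ⟨(integrable_congr h3).2 (integrable_zero _ _ _), ?_⟩
    simp only [Prod.fst_zero, Prod.snd_zero]
    rw [integral_congr_ae h3, h2]; simp
  add_mem' := by
    intro X Y hX hY k
    filter_upwards [hX k, hY k, ae_ae_cons m (Fock.wave_add X.1 Y.1 (k + 1)),
      Fock.wave_add X.2 Y.2 k] with q hXq hYq h1 h2
    have h3 : (fun p => c p * (X.1 + Y.1).wave (k + 1) (Fin.cons p q))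
        =ᵐ[shellMeasure m] fun p => c p * X.1.wave (k + 1) (Fin.cons p q) +
          c p * Y.1.wave (k + 1) (Fin.cons p q) := by
      filter_upwards [h1] with p hp
      rw [hp, Pi.add_apply, mul_add]
    refine ⟨(integrable_congr h3).2 (hXq.1.add hYq.1), ?_⟩
    simp only [Prod.fst_add, Prod.snd_add]
    rw [integral_congr_ae h3, h2, integral_add hXq.1 hYq.1, Pi.add_apply, hXq.2, hYq.2, mul_add]
  smul_mem' := by
    intro a X hX k
    filter_upwards [hX k, ae_ae_cons m (Fock.wave_smul a X.1 (k + 1)),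
      Fock.wave_smul a X.2 k] with q hXq h1 h2
    have h3 : (fun p => c p * (a • X.1).wave (k + 1) (Fin.cons p q))
        =ᵐ[shellMeasure m] fun p => a * (c p * X.1.wave (k + 1) (Fin.cons p q)) := by
      filter_upwards [h1] with p hp
      rw [hp, Pi.smul_apply, smul_eq_mul]; ring
    refine ⟨(integrable_congr h3).2 (hXq.1.const_mul a), ?_⟩
    simp only [Prod.smul_fst, Prod.smul_snd]
    rw [integral_congr_ae h3, h2, integral_const_mul, Pi.smul_apply, hXq.2, smul_eq_mul]; ring

theorem annihilationGraph_functional (m : ℝ) (c : E3 → ℂ) (X : Fock m × Fock m)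
    (hX : X ∈ annihilationGraph m c) (h0 : X.1 = 0) : X.2 = 0 := by
  have key : ∀ k, X.2 k = 0 := by
    intro k
    apply Subtype.ext
    refine Lp.ext ?_
    refine EventuallyEq.trans ?_ (Lp.coeFn_zero ℂ 2 (shellMeasurePi m k)).symm
    have hk := hX k
    filter_upwards [hk, ae_ae_cons m (Fock.wave_zero m (k + 1))] with q hq h1
    have h3 : (fun p => c p * X.1.wave (k + 1) (Fin.cons p q))
        =ᵐ[shellMeasure m] fun _ => 0 := by
      filter_upwards [h1] with p hp
      rw [h0, hp]; simp
    have h4 := hq.2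
    rw [integral_congr_ae h3] at h4
    simpa [Fock.wave] using h4
  exact lp.ext (funext key)

/-- The (unbounded) operator `∫ d³𝐩/(2ω_𝐩) c(𝐩) a_c(𝐩)` on its maximal domain. For square-integrable
`f` the annihilation operator `a_c(f)` is the case `c = conj f`. -/
def annihilation (m : ℝ) (c : E3 → ℂ) : Fock m →ₗ.[ℂ] Fock m :=
  (annihilationGraph m c).toLinearPMap

theorem annihilation_graph (m : ℝ) (c : E3 → ℂ) :
    (annihilation m c).graph = annihilationGraph m c :=
  Submodule.toLinearPMap_graph_eq _ (fun X hX h0 => annihilationGraph_functional m c X hX h0)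

/-- The operator `∫ d³𝐩 c(𝐩) a(𝐩)` with the non-covariant `a(𝐩) = a_c(𝐩) / √(2ω_𝐩)`. -/
def annihilationNC (m : ℝ) (c : E3 → ℂ) : Fock m →ₗ.[ℂ] Fock m :=
  annihilation m (fun p => (2 * omega m p : ℝ) * (c p / (√(2 * omega m p) : ℝ)))

/-- The localized wave function
`Ψ_{𝐱,x⁰}(𝐩) = (2π)^(-3/2) e^{i p·x} (2ω_𝐩)^{1/2}`, with `p = (ω_𝐩, 𝐩)`. -/
def localizedWave (m : ℝ) (x : SpaceTime) (p : E3) : ℂ :=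
  (((2 * π) ^ (-(3 / 2) : ℝ) : ℝ) : ℂ) * Complex.exp (Complex.I * (shellDot m p x : ℝ)) *
    (√(2 * omega m p) : ℝ)

/-- `φ₁(x) = ∫ d³𝐩/(2ω_𝐩) conj Ψ_{𝐱,x⁰}(𝐩) a_c(𝐩)`. -/
def phi1 (m : ℝ) (x : SpaceTime) : Fock m →ₗ.[ℂ] Fock m :=
  annihilation m (fun p => (starRingEnd ℂ) (localizedWave m x p))

/-- The coordinate space annihilation operator
`ã(𝐱) = (2π)^(-3/2) ∫ d³𝐩 e^{i 𝐩·𝐱} a(𝐩)` (Euclidean product in the exponent). -/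
def aTilde (m : ℝ) (x : E3) : Fock m →ₗ.[ℂ] Fock m :=
  annihilationNC m (fun p => (((2 * π) ^ (-(3 / 2) : ℝ) : ℝ) : ℂ) *
    Complex.exp (Complex.I * (inner ℝ p x : ℝ)))

/-- The finite-particle vectors whose wave functions are Schwartz functions. -/
def schwartzCore (m : ℝ) : Set (Fock m) :=
  {Ψ | (∃ N : ℕ, ∀ k, N ≤ k → Ψ k = 0) ∧
    ∀ k, ∃ g : SchwartzMap (Fin k → E3) ℂ, Ψ.wave k =ᵐ[shellMeasurePi m k] g}

/-- The rotation of `ℝ³` given by a matrix in `SO(3)`. -/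
def rot (R : Matrix.specialOrthogonalGroup (Fin 3) ℝ) : E3 ≃ₗᵢ[ℝ] E3 :=
  Unitary.linearIsometryEquiv
    ⟨Matrix.toEuclideanCLM (𝕜 := ℝ) (R : Matrix (Fin 3) (Fin 3) ℝ),
      Unitary.map_mem (Matrix.toEuclideanCLM (𝕜 := ℝ) (n := Fin 3)) R.2.1⟩

theorem rot_apply (R : Matrix.specialOrthogonalGroup (Fin 3) ℝ) (p : E3) :
    rot R p = WithLp.toLp 2 ((R : Matrix (Fin 3) (Fin 3) ℝ).mulVec p.ofLp) := rfl

theorem omega_isometry (m : ℝ) (e : E3 ≃ₗᵢ[ℝ] E3) (p : E3) : omega m (e p) = omega m p := by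
  simp [omega]

theorem measurePreserving_isometry (m : ℝ) (e : E3 ≃ₗᵢ[ℝ] E3) :
    MeasurePreserving e (shellMeasure m) (shellMeasure m) := by
  refine ⟨e.continuous.measurable, ?_⟩
  have hv := e.measurePreserving
  ext s hs
  rw [Measure.map_apply e.continuous.measurable hs]
  unfold shellMeasure
  rw [withDensity_apply _ hs, withDensity_apply _ (e.continuous.measurable hs)]
  have := hv.setLIntegral_comp_preimage hs (f := fun p => ENNReal.ofReal (1 / (2 * omega m p)))
    (by have := (continuous_omega m).measurable; fun_prop)
  rw [← this]
  simp only [omega_isometry]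

theorem measurePreserving_rotPi (m : ℝ) (e : E3 ≃ₗᵢ[ℝ] E3) (k : ℕ) :
    MeasurePreserving (fun (p : Fin k → E3) j => e (p j))
      (shellMeasurePi m k) (shellMeasurePi m k) :=
  measurePreserving_pi _ _ (fun _ => measurePreserving_isometry m e)

/-- The phase `e^{i(p₁ + ⋯ + p_k)·y}` of `k` on-shell momenta. -/
def phase (m : ℝ) (y : SpaceTime) {k : ℕ} (p : Fin k → E3) : ℂ :=
  Complex.exp (Complex.I * ((∑ j, shellDot m (p j) y : ℝ) : ℂ))

theorem norm_phase (m : ℝ) (y : SpaceTime) {k : ℕ} (p : Fin k → E3) : ‖phase m y p‖ = 1 := by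
  unfold phase; rw [mul_comm]; exact Complex.norm_exp_ofReal_mul_I _

theorem continuous_phase (m : ℝ) (y : SpaceTime) (k : ℕ) :
    Continuous (fun p : Fin k → E3 => phase m y p) := by
  unfold phase
  have := continuous_shellDot m y
  fun_prop

theorem memLp_act (m : ℝ) (y : SpaceTime) (e : E3 ≃ₗᵢ[ℝ] E3) {k : ℕ}
    (f : Lp ℂ 2 (shellMeasurePi m k)) :
    MemLp (fun p => phase m y p * f (fun j => e.symm (p j))) 2 (shellMeasurePi m k) := by
  have h1 : MemLp (fun p => f (fun j => e.symm (p j))) 2 (shellMeasurePi m k) :=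
    (Lp.memLp f).comp_measurePreserving (measurePreserving_rotPi m e.symm k)
  refine h1.of_le ((continuous_phase m y k).aestronglyMeasurable.mul h1.1) ?_
  exact ae_of_all _ fun p => by simp [norm_phase]

/-- The `k`-particle transformation
`Ψ(𝐩₁,…,𝐩_k) ↦ e^{i(p₁+⋯+p_k)·y} Ψ(R⁻¹𝐩₁,…,R⁻¹𝐩_k)` on square-integrable functions. -/
def act (m : ℝ) (y : SpaceTime) (e : E3 ≃ₗᵢ[ℝ] E3) (k : ℕ)
    (f : Lp ℂ 2 (shellMeasurePi m k)) : Lp ℂ 2 (shellMeasurePi m k) :=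
  (memLp_act m y e f).toLp

theorem coeFn_act (m : ℝ) (y : SpaceTime) (e : E3 ≃ₗᵢ[ℝ] E3) (k : ℕ)
    (f : Lp ℂ 2 (shellMeasurePi m k)) :
    act m y e k f =ᵐ[shellMeasurePi m k] fun p => phase m y p * f (fun j => e.symm (p j)) :=
  MemLp.coeFn_toLp _

theorem act_add (m : ℝ) (y : SpaceTime) (e : E3 ≃ₗᵢ[ℝ] E3) (k : ℕ)
    (f g : Lp ℂ 2 (shellMeasurePi m k)) : act m y e k (f + g) = act m y e k f + act m y e k g := by
  refine Lp.ext ?_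
  filter_upwards [coeFn_act m y e k (f + g), coeFn_act m y e k f, coeFn_act m y e k g,
    Lp.coeFn_add (act m y e k f) (act m y e k g),
    (measurePreserving_rotPi m e.symm k).quasiMeasurePreserving.ae (Lp.coeFn_add f g)]
    with p h1 h2 h3 h4 h5
  rw [h1, h4, Pi.add_apply, h2, h3, h5, Pi.add_apply, mul_add]

theorem act_smul (m : ℝ) (y : SpaceTime) (e : E3 ≃ₗᵢ[ℝ] E3) (k : ℕ) (c : ℂ)
    (f : Lp ℂ 2 (shellMeasurePi m k)) : act m y e k (c • f) = c • act m y e k f := by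
  refine Lp.ext ?_
  filter_upwards [coeFn_act m y e k (c • f), coeFn_act m y e k f,
    Lp.coeFn_smul c (act m y e k f),
    (measurePreserving_rotPi m e.symm k).quasiMeasurePreserving.ae (Lp.coeFn_smul c f)]
    with p h1 h2 h3 h4
  rw [h1, h3, Pi.smul_apply, h2, h4, Pi.smul_apply, smul_eq_mul, smul_eq_mul]; ring

theorem norm_act (m : ℝ) (y : SpaceTime) (e : E3 ≃ₗᵢ[ℝ] E3) (k : ℕ)
    (f : Lp ℂ 2 (shellMeasurePi m k)) : ‖act m y e k f‖ = ‖f‖ := by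
  rw [← Lp.norm_compMeasurePreserving f (measurePreserving_rotPi m e.symm k)]
  simp only [Lp.norm_def]
  congr 1
  refine eLpNorm_congr_norm_ae ?_
  filter_upwards [coeFn_act m y e k f,
    Lp.coeFn_compMeasurePreserving f (measurePreserving_rotPi m e.symm k)] with p h1 h2
  rw [h1, h2, norm_mul, norm_phase, one_mul]; rfl

theorem act_mem_symmSpace (m : ℝ) (y : SpaceTime) (e : E3 ≃ₗᵢ[ℝ] E3) (k : ℕ)
    {f : Lp ℂ 2 (shellMeasurePi m k)} (hf : f ∈ symmSpace m k) :
    act m y e k f ∈ symmSpace m k := by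
  intro σ
  have h1 := coeFn_act m y e k f
  filter_upwards [h1, (measurePreserving_perm m σ).quasiMeasurePreserving.ae h1,
    (measurePreserving_rotPi m e.symm k).quasiMeasurePreserving.ae (hf σ)] with p h2 h3 h4
  rw [h3, h2, ← h4]
  have h5 : phase m y (p ∘ σ) = phase m y p := by
    unfold phase
    congr 3
    exact Equiv.sum_comp σ (fun j => shellDot m (p j) y)
  rw [h5]; rfl

/-- The inverse transformation: `(y, R)⁻¹ = (-R⁻¹y, R⁻¹)`. -/
theorem act_act_inv (m : ℝ) (y : SpaceTime) (e : E3 ≃ₗᵢ[ℝ] E3) (k : ℕ)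
    (f : Lp ℂ 2 (shellMeasurePi m k)) :
    act m y e k (act m (-y.1, -e.symm y.2) e.symm k f) = f := by
  refine Lp.ext ?_
  filter_upwards [coeFn_act m y e k (act m (-y.1, -e.symm y.2) e.symm k f),
    (measurePreserving_rotPi m e.symm k).quasiMeasurePreserving.ae
      (coeFn_act m (-y.1, -e.symm y.2) e.symm k f)] with p h1 h2
  rw [h1, h2, ← mul_assoc]
  have h3 : phase m y p * phase m (-y.1, -e.symm y.2) (fun j => e.symm (p j)) = 1 := by
    unfold phase
    rw [← Complex.exp_add, ← mul_add, ← Complex.ofReal_add, ← Finset.sum_add_distrib]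
    simp [shellDot, omega_isometry]
  rw [h3, one_mul]
  simp

/-- The `k`-particle unitary. -/
def unitaryK (m : ℝ) (y : SpaceTime) (e : E3 ≃ₗᵢ[ℝ] E3) (k : ℕ) :
    symmSpace m k →ₗᵢ[ℂ] symmSpace m k where
  toFun f := ⟨act m y e k f, act_mem_symmSpace m y e k f.2⟩
  map_add' f g := Subtype.ext (act_add m y e k f g)
  map_smul' c f := Subtype.ext (act_smul m y e k c f)
  norm_map' f := norm_act m y e k f

theorem memlp_unitaryK (m : ℝ) (y : SpaceTime) (e : E3 ≃ₗᵢ[ℝ] E3) (Ψ : Fock m) :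
    Memℓp (fun k => unitaryK m y e k (Ψ k)) 2 := by
  have h := lp.memℓp Ψ
  have h2 : 0 < (2 : ENNReal).toReal := by norm_num
  rw [memℓp_gen_iff h2] at h ⊢
  simpa using h

def fockIsometry (m : ℝ) (y : SpaceTime) (e : E3 ≃ₗᵢ[ℝ] E3) : Fock m →ₗᵢ[ℂ] Fock m where
  toFun Ψ := ⟨fun k => unitaryK m y e k (Ψ k), memlp_unitaryK m y e Ψ⟩
  map_add' Ψ Φ := lp.ext (funext fun k => (unitaryK m y e k).map_add (Ψ k) (Φ k))
  map_smul' c Ψ := lp.ext (funext fun k => (unitaryK m y e k).map_smul c (Ψ k))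
  norm_map' Ψ := by
    have h2 : 0 < (2 : ENNReal).toReal := by norm_num
    rw [lp.norm_eq_tsum_rpow h2, lp.norm_eq_tsum_rpow h2]
    simp

theorem fockIsometry_surjective (m : ℝ) (y : SpaceTime) (e : E3 ≃ₗᵢ[ℝ] E3) :
    Function.Surjective (fockIsometry m y e) := fun Φ =>
  ⟨fockIsometry m (-y.1, -e.symm y.2) e.symm Φ,
    lp.ext (funext fun k => Subtype.ext (act_act_inv m y e k (Φ k)))⟩

/-- The unitary operator `U(y, Λ_R)` on Fock space that represents the rotation `R` followed by the
space-time translation `y`: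
`(U(y, Λ_R) Ψ)_k(𝐩₁,…,𝐩_k) = e^{i(p₁+⋯+p_k)·y} Ψ_k(R⁻¹𝐩₁,…,R⁻¹𝐩_k)`,
so that `U(y, Λ_R) a_c(𝐩) U(y, Λ_R)⁻¹ = e^{-i(Λ_R p)·y} a_c(R𝐩)`. -/
def U (m : ℝ) (y : SpaceTime) (R : Matrix.specialOrthogonalGroup (Fin 3) ℝ) :
    Fock m ≃ₗᵢ[ℂ] Fock m :=
  LinearIsometryEquiv.ofSurjective (fockIsometry m y (rot R))
    (fockIsometry_surjective m y (rot R))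

theorem U_wave (m : ℝ) (y : SpaceTime) (R : Matrix.specialOrthogonalGroup (Fin 3) ℝ)
    (Ψ : Fock m) (k : ℕ) :
    (U m y R Ψ).wave k =ᵐ[shellMeasurePi m k]
      fun p => phase m y p * Ψ.wave k (fun j => (rot R).symm (p j)) :=
  coeFn_act m y (rot R) k (Ψ k)

/-- The conjugated operator `V A V⁻¹`, with domain `V (dom A)`. -/
def conjugate {m : ℝ} (V : Fock m ≃ₗᵢ[ℂ] Fock m) (A : Fock m →ₗ.[ℂ] Fock m) :
    Fock m →ₗ.[ℂ] Fock m where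
  domain := A.domain.comap V.symm.toLinearEquiv.toLinearMap
  toFun := V.toLinearEquiv.toLinearMap ∘ₗ A.toFun ∘ₗ
    V.symm.toLinearEquiv.toLinearMap.submoduleComap A.domain

theorem conjugate_apply {m : ℝ} (V : Fock m ≃ₗᵢ[ℂ] Fock m) (A : Fock m →ₗ.[ℂ] Fock m)
    (Ψ : (conjugate V A).domain) : conjugate V A Ψ = V (A ⟨V.symm Ψ, Ψ.2⟩) := rfl

/-- The modified Bessel function of the second kind, for `Re w > 0`. -/
def besselK (ν : ℝ) (w : ℂ) : ℂ :=
  ∫ s in Set.Ioi (0 : ℝ), Complex.exp (-w * (Real.cosh s : ℝ)) * (Real.cosh (ν * s) : ℝ)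

/-- The kernel `(i t / 2π²) m² K₂(m √(|𝐯|² - t²)) / (|𝐯|² - t²)` (principal square root), as a
function of a possibly complex time `t`. -/
def timeKernel (m : ℝ) (t : ℂ) (v : E3) : ℂ :=
  Complex.I * t / (2 * (π : ℂ) ^ 2) *
    ((m : ℂ) ^ 2 * besselK 2 (m * Complex.sqrt ((‖v‖ : ℂ) ^ 2 - t ^ 2)) /
      ((‖v‖ : ℂ) ^ 2 - t ^ 2))

end ScalarField

end

noncomputable section

namespace ScalarField

/-! Covariance is a change of variables. Conjugation by `U` turns the annihilation operator with
coefficient `c` into the one with coefficient `c'`, where `c'(𝐩) e^{ip·y} = c(R⁻¹𝐩)`, because the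
shell measure is rotation invariant (`U_mem_annihilationGraph`). This is an equivalence of graph
conditions, so domains are included. Applied to `e^{-ip·x}` it gives the law for `φ₁`. Since `ã(𝐱) =
φ₁(0, 𝐱)`, the conjugate of `ã(𝐱)` is `φ₁(y⁰, R𝐱 + 𝐲)`.

It remains to express time evolution as a convolution. For `Im t < 0` the kernel is `(2π)⁻³ ∫
e^{i𝐯·𝐩} e^{-iωt} d³𝐩` (`timeKernel_eq_integral`). At `t = -is`, `e^{-sω}` is a superposition of
Gaussians `e^{-ω²e^u}` (`integral_levy`). Their Fourier transforms are explicit, and the remaining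
integral over `u` is a `K₂`. The identity theorem extends the formula to the lower half-plane. By
Fourier inversion, convolution with the kernel multiplies `e^{i𝐩·𝐳}` by `e^{-iωt}`.

To carry this over to Fock vectors, fix `Ψ` in the core. The map from coefficients to annihilated
vectors is bounded from the uniform norm to Fock space (`exists_annihilation_clm`), so it commutes
with Bochner integrals and limits. Plane waves are divided by `ω` to make them uniformly continuous
in position and uniformly convergent as `ε → 0`; the compensating factor `ω` is absorbed by the
Schwartz decay of `Ψ`. -/

/-! ### Integrals of `e^{-x cosh t}` and the Lévy subordination formula -/

theorem exp_neg_le_factorial_div_pow {x : ℝ} (hx : 0 < x) (n : ℕ) :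
    Real.exp (-x) ≤ n.factorial / x ^ n := by
  have h := Real.pow_div_factorial_le_exp (x := x) hx.le n
  have h1 : (0 : ℝ) < n.factorial := by positivity
  rw [Real.exp_neg, inv_le_comm₀ (Real.exp_pos _) (by positivity), inv_div]
  exact h

theorem one_add_sq_le_cosh_sq (t : ℝ) : 1 + t ^ 2 ≤ Real.cosh t ^ 2 := by
  rw [Real.cosh_sq']
  have h : |t| ≤ Real.sinh |t| := Real.self_le_sinh_iff.2 (abs_nonneg t)
  have h2 : Real.sinh |t| ^ 2 = Real.sinh t ^ 2 := by
    rcases abs_choice t with h | h <;> rw [h]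
    rw [Real.sinh_neg, neg_sq]
  have h3 := pow_le_pow_left₀ (abs_nonneg t) h 2
  rw [sq_abs, h2] at h3
  linarith

/-- The fourth power serves two purposes. After `cosh 2t ≤ 2 cosh² t`, two powers of `cosh t` are
left to make the bound integrable in `t`. The factor `x⁻⁴` later gives the kernel enough decay to be
integrable over ℝ³. The constant is `48 = 2 · 4!`. -/
theorem exp_neg_mul_cosh_mul_cosh_two_mul_le {x : ℝ} (hx : 0 < x) (t : ℝ) :
    Real.exp (-x * Real.cosh t) * Real.cosh (2 * t) ≤ 48 / x ^ 4 * (1 + t ^ 2)⁻¹ := by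
  have hc : 0 < Real.cosh t := Real.cosh_pos t
  have h1 := exp_neg_le_factorial_div_pow (mul_pos hx hc) 4
  have h2 : Real.cosh (2 * t) ≤ 2 * Real.cosh t ^ 2 := by
    rw [Real.cosh_two_mul, Real.sinh_sq]; linarith
  calc Real.exp (-x * Real.cosh t) * Real.cosh (2 * t)
      ≤ ((Nat.factorial 4 : ℕ) / (x * Real.cosh t) ^ 4) * (2 * Real.cosh t ^ 2) := by
        rw [neg_mul]
        exact mul_le_mul h1 h2 (Real.cosh_pos _).le (by positivity)
    _ = 48 / x ^ 4 * (Real.cosh t ^ 2)⁻¹ := by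
        have : (Nat.factorial 4 : ℝ) = 24 := by norm_num [Nat.factorial]
        rw [this]
        field_simp
        norm_num
    _ ≤ _ := by
        gcongr
        exact one_add_sq_le_cosh_sq t

theorem integrable_exp_neg_mul_cosh_mul_cosh_two_mul {x : ℝ} (hx : 0 < x) :
    Integrable fun t : ℝ => Real.exp (-x * Real.cosh t) * Real.cosh (2 * t) := by
  refine (integrable_inv_one_add_sq.const_mul (48 / x ^ 4)).mono'
    (by fun_prop) (ae_of_all _ fun t => ?_)
  rw [Real.norm_of_nonneg (mul_nonneg (Real.exp_pos _).le (Real.cosh_pos _).le)]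
  exact exp_neg_mul_cosh_mul_cosh_two_mul_le hx t

/-- An exponential weight may be replaced by the hyperbolic cosine in an integral against an
even function. -/
theorem integral_exp_mul_of_even {f : ℝ → ℝ} (hf : ∀ t, f (-t) = f t) (hm : Continuous f)
    (h0 : ∀ t, 0 ≤ f t) (a : ℝ) (hi : Integrable fun t => f t * Real.cosh (a * t)) :
    Integrable (fun t => Real.exp (-a * t) * f t) ∧
      ∫ t, Real.exp (-a * t) * f t = ∫ t, f t * Real.cosh (a * t) := by
  have h1 : Integrable (fun t => Real.exp (-a * t) * f t) := by
    refine (hi.const_mul 2).mono' (by fun_prop) (ae_of_all _ fun t => ?_)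
    rw [Real.norm_of_nonneg (mul_nonneg (Real.exp_pos _).le (h0 t)), Real.cosh_eq]
    have := mul_nonneg (h0 t) (Real.exp_pos (a * t)).le
    rw [neg_mul]
    linarith
  refine ⟨h1, ?_⟩
  have h2 : ∫ t, Real.exp (a * t) * f t = ∫ t, Real.exp (-a * t) * f t := by
    rw [← integral_neg_eq_self]
    simp [hf]
  have h3 : Integrable (fun t => Real.exp (a * t) * f t) := by
    have := h1.comp_neg
    simpa [hf] using this
  have h4 : ∀ t, f t * Real.cosh (a * t) =
      2⁻¹ * (Real.exp (a * t) * f t + Real.exp (-a * t) * f t) := by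
    intro t; rw [Real.cosh_eq, neg_mul]; ring
  simp_rw [h4]
  rw [integral_const_mul, integral_add h3 h1, h2]
  ring

/-- Since `cosh t = 1 + 2 sinh²(t/2)`, the substitution `w = sinh(t/2)` turns this into the Gaussian
integral of `e^{-2xw²}`; `cosh(t/2)` is, up to a factor 2, the Jacobian. -/
theorem integral_exp_neg_mul_cosh_mul_cosh_half {x : ℝ} (hx : 0 < x) :
    Integrable (fun t : ℝ => Real.exp (-x * Real.cosh t) * Real.cosh (1 / 2 * t)) ∧
      ∫ t : ℝ, Real.exp (-x * Real.cosh t) * Real.cosh (1 / 2 * t) =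
        √(2 * π / x) * Real.exp (-x) := by
  have hd : ∀ t ∈ (Set.univ : Set ℝ), HasDerivWithinAt (fun t => Real.sinh (1 / 2 * t))
      (Real.cosh (1 / 2 * t) * (1 / 2)) Set.univ t := by
    intro t _
    have := ((hasDerivAt_id t).const_mul (1 / 2 : ℝ)).sinh
    simpa using this
  have hinj : Set.InjOn (fun t : ℝ => Real.sinh (1 / 2 * t)) Set.univ := by
    intro a _ b _ h
    have := Real.sinh_injective h
    linarith
  have himg : (fun t : ℝ => Real.sinh (1 / 2 * t)) '' Set.univ = Set.univ := by
    rw [Set.image_univ, Set.range_eq_univ]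
    intro y
    obtain ⟨z, hz⟩ := Real.sinh_surjective y
    exact ⟨2 * z, by simp [hz]⟩
  have hrw : ∀ t : ℝ, Real.exp (-x * Real.cosh t) * Real.cosh (1 / 2 * t) =
      (2 * Real.exp (-x)) * (|Real.cosh (1 / 2 * t) * (1 / 2)| •
        Real.exp (-(2 * x) * Real.sinh (1 / 2 * t) ^ 2)) := by
    intro t
    have h1 : Real.cosh t = 1 + 2 * Real.sinh (1 / 2 * t) ^ 2 := by
      have : t = 2 * (1 / 2 * t) := by ring
      conv_lhs => rw [this]
      rw [Real.cosh_two_mul, Real.cosh_sq]; ring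
    have h2 : Real.exp (-x * Real.cosh t) =
        Real.exp (-x) * Real.exp (-(2 * x) * Real.sinh (1 / 2 * t) ^ 2) := by
      rw [← Real.exp_add, h1]; congr 1; ring
    rw [abs_of_pos (by have := Real.cosh_pos (1 / 2 * t); positivity), h2, smul_eq_mul]
    ring
  simp_rw [hrw]
  have hI := integrableOn_image_iff_integrableOn_abs_deriv_smul MeasurableSet.univ hd hinj
    (fun w => Real.exp (-(2 * x) * w ^ 2))
  have hE := integral_image_eq_integral_abs_deriv_smul MeasurableSet.univ hd hinj
    (fun w => Real.exp (-(2 * x) * w ^ 2))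
  rw [himg] at hI hE
  simp only [integrableOn_univ, Measure.restrict_univ] at hI hE
  refine ⟨(hI.1 (integrable_exp_neg_mul_sq (by positivity))).const_mul _, ?_⟩
  rw [integral_const_mul, ← hE, integral_gaussian]
  have h4 : √(2 * π / x) = 2 * √(π / (2 * x)) := by
    rw [show 2 * π / x = 2 ^ 2 * (π / (2 * x)) by field_simp,
      Real.sqrt_mul (by positivity), Real.sqrt_sq (by norm_num)]
  rw [h4]; ring

theorem exp_neg_half_mul_exp_add_exp (x c u : ℝ) :
    Real.exp (-(x / 2) * (Real.exp (c - u) + Real.exp (u - c))) =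
      Real.exp (-x * Real.cosh (u - c)) := by
  rw [Real.cosh_eq, neg_sub]; congr 1; ring

/-- The Laplace transform of the Lévy distribution, in a logarithmic variable. -/
theorem integral_levy {τ a : ℝ} (hτ : 0 < τ) (ha : 0 < a) :
    Integrable (fun u : ℝ => Real.exp (-(1 / 2) * u) *
      Real.exp (-(τ ^ 2 / 4) * Real.exp (-u) - a ^ 2 * Real.exp u)) ∧
    ∫ u : ℝ, Real.exp (-(1 / 2) * u) *
      Real.exp (-(τ ^ 2 / 4) * Real.exp (-u) - a ^ 2 * Real.exp u) =
        2 * √π / τ * Real.exp (-(τ * a)) := by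
  -- At `u = c` the terms `(τ²/4)e^{-u}` and `a²e^u` are equal, both `τa/2`. Centred there, the
  -- exponent becomes `-τa cosh(u - c)`, and evenness reduces the integral to a cosine-hyperbolic
  -- one.
  set c := Real.log (τ / (2 * a)) with hc
  have hec : Real.exp c = τ / (2 * a) := Real.exp_log (by positivity)
  have hrw : ∀ u : ℝ, Real.exp (-(1 / 2) * u) *
      Real.exp (-(τ ^ 2 / 4) * Real.exp (-u) - a ^ 2 * Real.exp u) =
      Real.exp (-(1 / 2) * c) * (Real.exp (-(1 / 2) * (u - c)) *
        Real.exp (-(τ * a) * Real.cosh (u - c))) := by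
    intro u
    rw [← mul_assoc, ← Real.exp_add (-(1 / 2) * c), ← exp_neg_half_mul_exp_add_exp]
    have h1 : ∀ b : ℝ, b * c + b * (u - c) = b * u := fun b => by ring
    rw [h1]
    congr 2
    rw [sub_eq_add_neg c u, Real.exp_add, Real.exp_sub, hec]
    field_simp
    ring
  obtain ⟨hI, hE⟩ := integral_exp_neg_mul_cosh_mul_cosh_half (mul_pos hτ ha)
  obtain ⟨hI', hE'⟩ := integral_exp_mul_of_even (f := fun t => Real.exp (-(τ * a) * Real.cosh t))
    (by simp) (by fun_prop) (fun t => (Real.exp_pos _).le) (1 / 2) hI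
  simp_rw [hrw]
  refine ⟨(hI'.comp_sub_right c).const_mul _, ?_⟩
  rw [integral_const_mul, integral_sub_right_eq_self (fun u => Real.exp (-(1 / 2) * u) *
        Real.exp (-(τ * a) * Real.cosh u)) c, hE', hE, ← mul_assoc]
  congr 1
  have h1 : Real.exp (-(1 / 2) * c) = √(2 * a / τ) := by
    rw [show -(1 / 2) * c = -c / 2 by ring, Real.exp_half, Real.exp_neg, hec, inv_div]
  rw [h1, ← Real.sqrt_mul (by positivity),
    show 2 * a / τ * (2 * π / (τ * a)) = (2 / τ) ^ 2 * π by field_simp,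
    Real.sqrt_mul (by positivity), Real.sqrt_sq (by positivity)]
  ring

/-- An integral representation of `K₂`, in a logarithmic variable. -/
theorem integral_exp_neg_two_mul_eq_besselK {r m : ℝ} (hr : 0 < r) (hm : 0 < m) :
    ∫ u : ℝ, Real.exp (-2 * u) *
      Real.exp (-(r ^ 2 / 4) * Real.exp (-u) - m ^ 2 * Real.exp u) =
        8 * m ^ 2 / r ^ 2 *
          ∫ s in Set.Ioi (0 : ℝ), Real.exp (-(m * r) * Real.cosh s) * Real.cosh (2 * s) := by
  set c := Real.log (r / (2 * m)) with hc
  have hec : Real.exp c = r / (2 * m) := Real.exp_log (by positivity)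
  have hrw : ∀ u : ℝ, Real.exp (-2 * u) *
      Real.exp (-(r ^ 2 / 4) * Real.exp (-u) - m ^ 2 * Real.exp u) =
      Real.exp (-2 * c) * (Real.exp (-2 * (u - c)) *
        Real.exp (-(m * r) * Real.cosh (u - c))) := by
    intro u
    rw [← mul_assoc, ← Real.exp_add (-2 * c), ← exp_neg_half_mul_exp_add_exp]
    have h1 : ∀ b : ℝ, b * c + b * (u - c) = b * u := fun b => by ring
    rw [h1]
    congr 2
    rw [sub_eq_add_neg c u, Real.exp_add, Real.exp_sub, hec]
    field_simp
    ring
  obtain ⟨hI', hE'⟩ := integral_exp_mul_of_even (f := fun t => Real.exp (-(m * r) * Real.cosh t))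
    (by simp) (by fun_prop) (fun t => (Real.exp_pos _).le) 2
    (integrable_exp_neg_mul_cosh_mul_cosh_two_mul (mul_pos hm hr))
  have habs : ∫ t, Real.exp (-(m * r) * Real.cosh t) * Real.cosh (2 * t) =
      2 * ∫ s in Set.Ioi (0 : ℝ), Real.exp (-(m * r) * Real.cosh s) * Real.cosh (2 * s) := by
    rw [← integral_comp_abs]
    congr 1; ext t
    rw [Real.cosh_abs, ← Real.cosh_abs (2 * t), abs_mul, abs_two]
  simp_rw [hrw]
  rw [integral_const_mul, integral_sub_right_eq_self (fun u => Real.exp (-2 * u) *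
        Real.exp (-(m * r) * Real.cosh u)) c, hE', habs]
  have h1 : Real.exp (-2 * c) = 4 * m ^ 2 / r ^ 2 := by
    rw [show -2 * c = -(2 * c) by ring, Real.exp_neg, two_mul c, Real.exp_add, hec]
    field_simp; norm_num
  rw [h1]; ring

/-! ### Bounds on the energy -/

theorem omega_pos {m : ℝ} (hm : 0 < m) (p : E3) : 0 < omega m p := by
  unfold omega; positivity

theorem omega_sq (m : ℝ) (p : E3) : omega m p ^ 2 = ‖p‖ ^ 2 + m ^ 2 := by
  unfold omega; rw [Real.sq_sqrt (by positivity)]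

theorem le_omega {m : ℝ} (hm : 0 < m) (p : E3) : m ≤ omega m p := by
  have := omega_sq m p
  nlinarith [omega_pos hm p, sq_nonneg ‖p‖]

theorem norm_le_omega (m : ℝ) (p : E3) : ‖p‖ ≤ omega m p := by
  unfold omega
  exact Real.le_sqrt_of_sq_le (by nlinarith [sq_nonneg m])

theorem one_add_norm_le_omega {m : ℝ} (hm : 0 < m) (p : E3) :
    1 + ‖p‖ ≤ (m⁻¹ + 1) * omega m p := by
  have h1 := le_omega hm p
  have h2 := norm_le_omega m p
  have h3 : 1 ≤ m⁻¹ * omega m p := by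
    rw [inv_mul_eq_div, le_div_iff₀ hm]; linarith
  linarith

theorem omega_le {m : ℝ} (hm : 0 < m) (p : E3) : omega m p ≤ (1 + m) * (1 + ‖p‖) := by
  unfold omega
  refine Real.sqrt_le_iff.2 ⟨by positivity, ?_⟩
  nlinarith [norm_nonneg p, sq_nonneg ‖p‖, mul_nonneg hm.le (norm_nonneg p),
    mul_nonneg hm.le (sq_nonneg ‖p‖), mul_nonneg (sq_nonneg m) (norm_nonneg p),
    mul_nonneg (sq_nonneg m) (sq_nonneg ‖p‖)]

/-- Four is the first integer exponent above the dimension 3. -/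
theorem integrable_inv_one_add_norm_pow_four :
    Integrable fun p : E3 => ((1 + ‖p‖) ^ 4)⁻¹ := by
  have h := integrable_one_add_norm (E := E3) (μ := volume) (r := 4) (by simp; norm_num)
  refine h.congr (ae_of_all _ fun p => ?_)
  simp only
  rw [Real.rpow_neg (by positivity)]
  norm_cast

theorem integrable_exp_neg_mul_omega {m : ℝ} (hm : 0 < m) {δ : ℝ} (hδ : 0 < δ) :
    Integrable fun p : E3 => Real.exp (-(δ * omega m p)) := by
  refine (integrable_inv_one_add_norm_pow_four.const_mul
    ((Nat.factorial 4 : ℕ) * ((m⁻¹ + 1) / δ) ^ 4)).mono' ?_ (ae_of_all _ fun p => ?_)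
  · have := continuous_omega m
    fun_prop
  · rw [Real.norm_of_nonneg (Real.exp_pos _).le]
    have hω := omega_pos hm p
    have h1 := one_add_norm_le_omega hm p
    refine (exp_neg_le_factorial_div_pow (by positivity) 4).trans ?_
    rw [div_eq_mul_inv, mul_assoc]
    gcongr
    rw [← div_eq_mul_inv, ← div_pow, ← inv_pow]
    gcongr
    rw [inv_eq_one_div, div_le_div_iff₀ (by positivity) (by positivity)]
    rw [one_mul, div_mul_eq_mul_div, ← mul_assoc, mul_comm _ δ, mul_assoc, mul_div_assoc,
      ← mul_div_assoc, mul_div_cancel_left₀ _ hδ.ne']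
    exact h1

/-! ### Holomorphy and decay of `K₂` -/

/-- Laplace integrals are holomorphic in the right half-plane. -/
theorem differentiableOn_laplace {α : Type*} [MeasurableSpace α] {μ : Measure α} {a : α → ℝ}
    {b : α → ℂ} (ha : Measurable a) (h0 : ∀ x, 0 ≤ a x)
    (hb : AEStronglyMeasurable b μ)
    (hi : ∀ δ : ℝ, 0 < δ → Integrable (fun x => b x * (Real.exp (-(δ * a x)) : ℝ)) μ) :
    DifferentiableOn ℂ (fun τ : ℂ => ∫ x, b x * Complex.exp (-(τ * a x)) ∂μ)
      {τ : ℂ | 0 < τ.re} := by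
  have hmeas : ∀ τ : ℂ, AEStronglyMeasurable (fun x => b x * Complex.exp (-(τ * a x))) μ := by
    intro τ
    exact hb.mul (by fun_prop : Measurable fun x => Complex.exp (-(τ * a x))).aestronglyMeasurable
  have hnorm : ∀ (τ : ℂ) x, ‖Complex.exp (-(τ * a x))‖ = Real.exp (-(τ.re * a x)) := by
    intro τ x
    rw [Complex.norm_exp]; simp
  intro τ hτ
  simp only [Set.mem_ofPred_eq] at hτ
  -- Half of the decay rate is given up to have a uniform rate `δ` near `τ`. Half of `δ` is then
  -- spent on the factor `a` from the derivative, through `a ≤ (2/δ) e^{δa/2}`.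
  set δ := τ.re / 2 with hδ
  have hδ0 : 0 < δ := by positivity
  have hs : {z : ℂ | δ < z.re} ∈ 𝓝 τ :=
    (isOpen_lt continuous_const Complex.continuous_re).mem_nhds (by simp [hδ]; linarith)
  refine ((hasDerivAt_integral_of_dominated_loc_of_deriv_le
    (F := fun (τ : ℂ) x => b x * Complex.exp (-(τ * a x)))
    (F' := fun (τ : ℂ) x => b x * (Complex.exp (-(τ * a x)) * (-(a x : ℂ))))
    (bound := fun x => 2 / δ * ‖b x * (Real.exp (-(δ / 2 * a x)) : ℝ)‖)
    hs (Eventually.of_forall hmeas) ?_ ?_ ?_ ?_ ?_).2).differentiableAt.differentiableWithinAt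
  · refine (hi τ.re hτ).mono (hmeas τ) (ae_of_all _ fun x => ?_)
    rw [norm_mul, norm_mul, hnorm, Complex.norm_real, Real.norm_of_nonneg (Real.exp_pos _).le]
  · refine hb.mul (Measurable.aestronglyMeasurable ?_)
    fun_prop
  · refine ae_of_all _ fun x z hz => ?_
    simp only [Set.mem_ofPred_eq] at hz
    rw [norm_mul, norm_mul, hnorm, norm_neg, Complex.norm_real, Real.norm_of_nonneg (h0 x),
      norm_mul, Complex.norm_real, Real.norm_of_nonneg (Real.exp_pos _).le]
    have h1 : Real.exp (-(z.re * a x)) ≤ Real.exp (-(δ * a x)) := by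
      apply Real.exp_le_exp.2
      have := mul_le_mul_of_nonneg_right hz.le (h0 x)
      linarith
    have h2 : a x ≤ 2 / δ * Real.exp (δ / 2 * a x) := by
      have := Real.add_one_le_exp (δ / 2 * a x)
      calc a x = 2 / δ * (δ / 2 * a x) := by field_simp
        _ ≤ _ := by gcongr; linarith
    calc ‖b x‖ * (Real.exp (-(z.re * a x)) * a x)
        ≤ ‖b x‖ * (Real.exp (-(δ * a x)) * (2 / δ * Real.exp (δ / 2 * a x))) := by
          gcongr
          exact h0 x
      _ = _ := by
        have : Real.exp (-(δ / 2 * a x)) = Real.exp (-(δ * a x)) * Real.exp (δ / 2 * a x) := by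
          rw [← Real.exp_add]; congr 1; ring
        rw [this]; ring
  · exact ((hi (δ / 2) (by positivity)).norm).const_mul _
  · refine ae_of_all _ fun x z _ => ?_
    have h1 : HasDerivAt (fun τ : ℂ => -(τ * a x)) (-(a x : ℂ)) z := by
      have h2 := (hasDerivAt_mul_const (x := z) (a x : ℂ)).neg
      exact h2
    exact (h1.cexp).const_mul (b x)

theorem norm_besselK_two_le :
    ∃ C : ℝ, 0 < C ∧ ∀ w : ℂ, 0 < w.re → ‖besselK 2 w‖ ≤ C / w.re ^ 4 := by
  set I := ∫ t in Set.Ioi (0 : ℝ), (1 + t ^ 2)⁻¹ with hI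
  have hI0 : 0 ≤ I := integral_nonneg fun t => by positivity
  refine ⟨48 * (I + 1), by positivity, fun w hw => ?_⟩
  unfold besselK
  have h1 := norm_integral_le_of_norm_le (μ := volume.restrict (Set.Ioi (0 : ℝ)))
    (f := fun s : ℝ => Complex.exp (-w * (Real.cosh s : ℝ)) * (Real.cosh (2 * s) : ℝ))
    ((integrable_inv_one_add_sq.const_mul (48 / w.re ^ 4)).restrict)
    (ae_of_all _ fun t => ?_)
  · refine h1.trans ?_
    rw [integral_const_mul, ← hI]
    have : 0 ≤ 48 / w.re ^ 4 := by positivity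
    calc 48 / w.re ^ 4 * I ≤ 48 / w.re ^ 4 * (I + 1) := by gcongr; linarith
      _ = _ := by ring
  · rw [norm_mul, Complex.norm_exp, Complex.norm_real, Real.norm_of_nonneg (Real.cosh_pos _).le]
    simpa using exp_neg_mul_cosh_mul_cosh_two_mul_le hw t

theorem besselK_two_ofReal (x : ℝ) : besselK 2 (x : ℂ) =
    ((∫ s in Set.Ioi (0 : ℝ), Real.exp (-x * Real.cosh s) * Real.cosh (2 * s) : ℝ) : ℂ) := by
  unfold besselK
  refine Eq.trans ?_ integral_ofReal
  congr 1; ext s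
  simp only [Complex.coe_algebraMap]
  push_cast
  rfl

theorem differentiableOn_besselK_two :
    DifferentiableOn ℂ (besselK 2) {w : ℂ | 0 < w.re} := by
  have h := differentiableOn_laplace (μ := volume.restrict (Set.Ioi (0 : ℝ)))
    (a := Real.cosh) (b := fun s : ℝ => ((Real.cosh (2 * s) : ℝ) : ℂ))
    Real.measurable_cosh (fun s => (Real.cosh_pos s).le)
    (by fun_prop)
    (fun δ hδ => by
      have := (integrable_exp_neg_mul_cosh_mul_cosh_two_mul hδ).ofReal (𝕜 := ℂ)
      refine (this.congr (ae_of_all _ fun s => ?_)).restrict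
      simp [mul_comm])
  refine h.congr fun w _ => ?_
  unfold besselK
  congr 1; ext s
  rw [mul_comm, neg_mul]

/-! ### Regularity and integrability of the time kernel -/

theorem re_sqrt_sq (z : ℂ) : (Complex.sqrt z).re ^ 2 = (‖z‖ + z.re) / 2 := by
  unfold Complex.sqrt
  rw [Complex.cpow_inv_two_re, Real.sq_sqrt]
  have := Complex.abs_re_le_norm z
  have := neg_abs_le z.re
  linarith

theorem re_sqrt_nonneg (z : ℂ) : 0 ≤ (Complex.sqrt z).re := by
  unfold Complex.sqrt
  rw [Complex.cpow_inv_two_re]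
  positivity

/-- If `Re √z = 0`, then `‖z‖ = -Re z`, which forces `z` onto the closed negative real axis. This
keeps the Bessel argument in the half-plane where its integral converges. -/
theorem re_sqrt_pos {z : ℂ} (hz : z ∈ Complex.slitPlane) : 0 < (Complex.sqrt z).re := by
  refine lt_of_le_of_ne (re_sqrt_nonneg z) fun h => ?_
  have h1 := re_sqrt_sq z
  rw [← h] at h1
  have h2 : ‖z‖ = -z.re := by linarith
  rw [Complex.mem_slitPlane_iff] at hz
  have h3 : 0 ≤ -z.re := h2 ▸ norm_nonneg z
  have h4 := Complex.sq_norm z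
  rw [h2, Complex.normSq_apply] at h4
  have h5 : z.im = 0 := by
    have : z.im * z.im = 0 := by linarith
    simpa using this
  rcases hz with hz | hz
  · linarith
  · exact hz h5

/-- The imaginary part `-2 Re t Im t` vanishes only for purely imaginary `t`, and there the value is
`r² + (Im t)² > 0`. Hence below the real axis the kernel has no singularity on any light cone. -/
theorem sq_sub_sq_mem_slitPlane {t : ℂ} (ht : t.im < 0) (r : ℝ) :
    (r : ℂ) ^ 2 - t ^ 2 ∈ Complex.slitPlane := by
  rw [Complex.mem_slitPlane_iff]
  by_cases h : t.re = 0
  · left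
    have : 0 < t.im ^ 2 := by nlinarith
    simp [pow_two, h]
    nlinarith [sq_nonneg r]
  · right
    have h1 : t.re * t.im ≠ 0 := mul_ne_zero h ht.ne
    have h2 : ((r : ℂ) ^ 2 - t ^ 2).im = -(2 * (t.re * t.im)) := by
      simp [pow_two]; ring
    rw [h2]
    simpa using h1

theorem differentiableAt_timeKernel {m : ℝ} (hm : 0 < m) {t : ℂ} {v : E3}
    (h : (‖v‖ : ℂ) ^ 2 - t ^ 2 ∈ Complex.slitPlane) :
    DifferentiableAt ℂ (fun t => timeKernel m t v) t := by
  have h0 : (‖v‖ : ℂ) ^ 2 - t ^ 2 ≠ 0 := Complex.slitPlane_ne_zero h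
  have h1 : DifferentiableAt ℂ (fun t : ℂ => (m : ℂ) * Complex.sqrt ((‖v‖ : ℂ) ^ 2 - t ^ 2)) t := by
    refine DifferentiableAt.const_mul ?_ _
    exact ((Complex.hasDerivAt_sqrt h).differentiableAt).comp t
      (f := fun t : ℂ => (‖v‖ : ℂ) ^ 2 - t ^ 2) (by fun_prop)
  have h2 : DifferentiableAt ℂ (besselK 2) ((m : ℂ) * Complex.sqrt ((‖v‖ : ℂ) ^ 2 - t ^ 2)) := by
    refine differentiableOn_besselK_two.differentiableAt
      ((isOpen_lt continuous_const Complex.continuous_re).mem_nhds ?_)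
    simpa using mul_pos hm (re_sqrt_pos h)
  have h3 : DifferentiableAt ℂ
      (fun t : ℂ => besselK 2 ((m : ℂ) * Complex.sqrt ((‖v‖ : ℂ) ^ 2 - t ^ 2))) t :=
    DifferentiableAt.comp (g := besselK 2) t h2 h1
  unfold timeKernel
  exact (by fun_prop : DifferentiableAt ℂ (fun t : ℂ => Complex.I * t / (2 * (π : ℂ) ^ 2)) t).mul
    ((h3.const_mul _).div (by fun_prop) h0)

/-- Joint continuity is needed for the locally uniform limit at real time; fixing `t` gives
continuity in space. -/
theorem continuousAt_timeKernel {m : ℝ} (hm : 0 < m) {q : ℂ × E3}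
    (h : (‖q.2‖ : ℂ) ^ 2 - q.1 ^ 2 ∈ Complex.slitPlane) :
    ContinuousAt (fun q : ℂ × E3 => timeKernel m q.1 q.2) q := by
  have h0 : (‖q.2‖ : ℂ) ^ 2 - q.1 ^ 2 ≠ 0 := Complex.slitPlane_ne_zero h
  have hz : Continuous (fun q : ℂ × E3 => (‖q.2‖ : ℂ) ^ 2 - q.1 ^ 2) := by fun_prop
  have h1 : ContinuousAt
      (fun q : ℂ × E3 => (m : ℂ) * Complex.sqrt ((‖q.2‖ : ℂ) ^ 2 - q.1 ^ 2)) q := by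
    refine ContinuousAt.mul continuousAt_const ?_
    exact ContinuousAt.comp (f := fun q : ℂ × E3 => (‖q.2‖ : ℂ) ^ 2 - q.1 ^ 2)
      (Complex.hasDerivAt_sqrt h).continuousAt hz.continuousAt
  have h2 : ContinuousAt (besselK 2) ((m : ℂ) * Complex.sqrt ((‖q.2‖ : ℂ) ^ 2 - q.1 ^ 2)) := by
    refine differentiableOn_besselK_two.continuousOn.continuousAt
      ((isOpen_lt continuous_const Complex.continuous_re).mem_nhds ?_)
    simpa using mul_pos hm (re_sqrt_pos h)
  have h3 : ContinuousAt
      (fun q : ℂ × E3 => besselK 2 ((m : ℂ) * Complex.sqrt ((‖q.2‖ : ℂ) ^ 2 - q.1 ^ 2))) q :=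
    ContinuousAt.comp (g := besselK 2) (f := fun q : ℂ × E3 => (m : ℂ) * Complex.sqrt ((‖q.2‖ : ℂ) ^ 2 - q.1 ^ 2))
      h2 h1
  unfold timeKernel
  exact (by fun_prop : Continuous
    (fun q : ℂ × E3 => Complex.I * q.1 / (2 * (π : ℂ) ^ 2))).continuousAt.mul
    ((continuousAt_const.mul h3).div hz.continuousAt h0)

theorem continuous_timeKernel {m : ℝ} (hm : 0 < m) {t : ℂ} (ht : t.im < 0) :
    Continuous (timeKernel m t) :=
  continuous_iff_continuousAt.2 fun v =>
    ContinuousAt.comp (f := fun v : E3 => (t, v)) (g := fun q : ℂ × E3 => timeKernel m q.1 q.2)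
      (continuousAt_timeKernel hm (sq_sub_sq_mem_slitPlane ht _))
      (by fun_prop : Continuous fun v : E3 => (t, v)).continuousAt

theorem integrable_timeKernel {m : ℝ} (hm : 0 < m) {t : ℂ} (ht : t.im < 0) :
    Integrable (timeKernel m t) := by
  refine (continuous_timeKernel hm ht).locallyIntegrable.integrable_of_isBigO_cocompact
    (g := fun v : E3 => ((1 + ‖v‖) ^ 4)⁻¹) ?_
    (integrable_inv_one_add_norm_pow_four.integrableAtFilter _)
  obtain ⟨C, hC, hK⟩ := norm_besselK_two_le
  -- For `‖v‖ ≥ max(2‖t‖, 1)`, `Re z ≥ ‖v‖²/2`. This gives `‖z‖⁻¹ ≤ 2` and `(Re √z)² ≥ ‖v‖²/2 ≥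
  -- (1+‖v‖)²/8`, whose square is the source of the 64.
  refine Asymptotics.IsBigO.of_bound
    (‖Complex.I * t / (2 * (π : ℂ) ^ 2)‖ * (m ^ 2 * (C / (m ^ 4 / 64)) * 2)) ?_
  have h1 : ∀ᶠ v : E3 in cocompact E3, max (2 * ‖t‖) 1 ≤ ‖v‖ :=
    (tendsto_norm_cocompact_atTop (E := E3)).eventually_ge_atTop _
  filter_upwards [h1] with v hv
  have hv1 : 2 * ‖t‖ ≤ ‖v‖ := (le_max_left _ _).trans hv
  have hv2 : 1 ≤ ‖v‖ := (le_max_right _ _).trans hv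
  have hz := sq_sub_sq_mem_slitPlane ht ‖v‖
  set z := (‖v‖ : ℂ) ^ 2 - t ^ 2 with hzdef
  have hre : ‖v‖ ^ 2 / 2 ≤ z.re := by
    have h2 : z.re = ‖v‖ ^ 2 - (t ^ 2).re := by
      rw [hzdef, ← Complex.ofReal_pow, Complex.sub_re, Complex.ofReal_re]
    have h3 : (t ^ 2).re ≤ ‖t‖ ^ 2 := by
      rw [← norm_pow]; exact Complex.re_le_norm _
    nlinarith [norm_nonneg t]
  have hzn : z.re ≤ ‖z‖ := Complex.re_le_norm z
  have hsq : ‖v‖ ^ 2 / 2 ≤ (Complex.sqrt z).re ^ 2 := by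
    rw [re_sqrt_sq]; linarith
  have hpos : 0 < (Complex.sqrt z).re := re_sqrt_pos hz
  have hw : ((m : ℂ) * Complex.sqrt z).re = m * (Complex.sqrt z).re := by simp
  have hb : ‖besselK 2 (m * Complex.sqrt z)‖ ≤ C / (m ^ 4 / 64) * ((1 + ‖v‖) ^ 4)⁻¹ := by
    refine (hK _ (by rw [hw]; positivity)).trans ?_
    rw [hw, ← div_eq_mul_inv, div_div]
    gcongr
    have h3 : ((1 + ‖v‖) / 2) ^ 2 / 2 ≤ (Complex.sqrt z).re ^ 2 := by
      refine le_trans ?_ hsq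
      gcongr
      linarith
    have h4 := pow_le_pow_left₀ (by positivity) h3 2
    calc m ^ 4 / 64 * (1 + ‖v‖) ^ 4 = m ^ 4 * (((1 + ‖v‖) / 2) ^ 2 / 2) ^ 2 := by ring
      _ ≤ m ^ 4 * ((Complex.sqrt z).re ^ 2) ^ 2 := by gcongr
      _ = _ := by ring
  have hz1 : ‖z‖⁻¹ ≤ 2 := by
    rw [inv_le_comm₀ (by nlinarith) (by norm_num)]
    nlinarith
  have hn : ‖timeKernel m t v‖ = ‖Complex.I * t / (2 * (π : ℂ) ^ 2)‖ *
      (m ^ 2 * ‖besselK 2 (m * Complex.sqrt z)‖ * ‖z‖⁻¹) := by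
    unfold timeKernel
    rw [← hzdef, norm_mul, norm_div (_ * _) z, norm_mul _ (besselK 2 _), norm_pow,
      Complex.norm_real, Real.norm_of_nonneg hm.le, div_eq_mul_inv (_ * _) ‖z‖]
  rw [hn, Real.norm_of_nonneg (by positivity),
    mul_assoc ‖Complex.I * t / (2 * (π : ℂ) ^ 2)‖]
  refine mul_le_mul_of_nonneg_left ?_ (norm_nonneg _)
  calc m ^ 2 * ‖besselK 2 (m * Complex.sqrt z)‖ * ‖z‖⁻¹
      ≤ m ^ 2 * (C / (m ^ 4 / 64) * ((1 + ‖v‖) ^ 4)⁻¹) * 2 := by gcongr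
    _ = _ := by ring

/-! ### The kernel as a Fourier transform -/

/-- The momentum integral in the subordination argument. Because `ω² = ‖p‖² + m²`, the integrand is
Gaussian in `p`. In dimension three its transform contributes `(π e^{-u})^{3/2}`, raising the weight
`e^{-u/2}` to the `e^{-2u}` that selects the Bessel index 2, and `‖v‖²` joins `s²` in the exponent.
-/
theorem integral_cexp_gaussian (s : ℝ) (u : ℝ) (m : ℝ) (v : E3) :
    ∫ p : E3, Complex.exp (Complex.I * (inner ℝ v p : ℝ)) *
      ((Real.exp (-(1 / 2) * u) * Real.exp (-(s ^ 2 / 4) * Real.exp (-u) -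
        omega m p ^ 2 * Real.exp u) : ℝ) : ℂ) =
    ((π * √π * (Real.exp (-2 * u) * Real.exp (-((‖v‖ ^ 2 + s ^ 2) / 4) * Real.exp (-u) -
        m ^ 2 * Real.exp u)) : ℝ) : ℂ) := by
  have hb : 0 < ((Real.exp u : ℝ) : ℂ).re := by
    rw [Complex.ofReal_re]; exact Real.exp_pos u
  have h := GaussianFourier.integral_cexp_neg_mul_sq_norm_add hb Complex.I v
  have hrw : ∀ p : E3, Complex.exp (Complex.I * (inner ℝ v p : ℝ)) *
      ((Real.exp (-(1 / 2) * u) * Real.exp (-(s ^ 2 / 4) * Real.exp (-u) -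
        omega m p ^ 2 * Real.exp u) : ℝ) : ℂ) =
      ((Real.exp (-(1 / 2) * u) * Real.exp (-(s ^ 2 / 4) * Real.exp (-u) -
        m ^ 2 * Real.exp u) : ℝ) : ℂ) *
        Complex.exp (-((Real.exp u : ℝ) : ℂ) * ‖p‖ ^ 2 + Complex.I * (inner ℝ v p : ℝ)) := by
    intro p
    rw [omega_sq, Complex.exp_add]
    have : Real.exp (-(s ^ 2 / 4) * Real.exp (-u) - (‖p‖ ^ 2 + m ^ 2) * Real.exp u) =
        Real.exp (-(s ^ 2 / 4) * Real.exp (-u) - m ^ 2 * Real.exp u) *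
          Real.exp (-Real.exp u * ‖p‖ ^ 2) := by
      rw [← Real.exp_add]; congr 1; ring
    rw [this]
    push_cast
    ring
  simp_rw [hrw]
  rw [integral_const_mul, h]
  have hpow : ((π : ℂ) / ((Real.exp u : ℝ) : ℂ)) ^ ((Module.finrank ℝ E3 : ℂ) / 2) =
      ((π * √π * Real.exp (-(3 / 2) * u) : ℝ) : ℂ) := by
    rw [finrank_euclideanSpace, Fintype.card_fin, ← Complex.ofReal_div]
    rw [show ((3 : ℕ) : ℂ) / 2 = ((3 / 2 : ℝ) : ℂ) by push_cast; rfl,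
      ← Complex.ofReal_cpow (by positivity), Real.div_rpow pi_pos.le (Real.exp_pos u).le,
      ← Real.exp_mul, div_eq_mul_inv, ← Real.exp_neg,
      show (3 / 2 : ℝ) = 1 + 1 / 2 by norm_num, Real.rpow_add pi_pos, Real.rpow_one,
      ← Real.sqrt_eq_rpow]
    congr 3; ring
  have hexp : Complex.exp (Complex.I ^ 2 * ‖v‖ ^ 2 / (4 * ((Real.exp u : ℝ) : ℂ))) =
      ((Real.exp (-(‖v‖ ^ 2 / 4) * Real.exp (-u)) : ℝ) : ℂ) := by
    rw [Real.exp_neg]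
    push_cast
    congr 1
    rw [Complex.I_sq]
    field_simp
  rw [hpow, hexp, ← Complex.ofReal_mul, ← Complex.ofReal_mul]
  congr 1
  have h1 : Real.exp (-2 * u) = Real.exp (-(1 / 2) * u) * Real.exp (-(3 / 2) * u) := by
    rw [← Real.exp_add]; congr 1; ring
  have h2 : Real.exp (-((‖v‖ ^ 2 + s ^ 2) / 4) * Real.exp (-u) - m ^ 2 * Real.exp u) =
      Real.exp (-(s ^ 2 / 4) * Real.exp (-u) - m ^ 2 * Real.exp u) *
        Real.exp (-(‖v‖ ^ 2 / 4) * Real.exp (-u)) := by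
    rw [← Real.exp_add]; congr 1; ring
  rw [h1, h2]; ring

theorem norm_cexp_I_mul_ofReal (x : ℝ) : ‖Complex.exp (Complex.I * (x : ℂ))‖ = 1 := by
  rw [mul_comm]; exact Complex.norm_exp_ofReal_mul_I x

/-- The Fourier transform of `e^{-sω}` for real `s`, by subordination to Gaussians. -/
theorem integral_cexp_mul_exp_neg_omega {m : ℝ} (hm : 0 < m) {s : ℝ} (hs : 0 < s) (v : E3) :
    ∫ p : E3, Complex.exp (Complex.I * (inner ℝ v p : ℝ)) *
      ((Real.exp (-(s * omega m p)) : ℝ) : ℂ) =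
    ((4 * π * s * m ^ 2 / (‖v‖ ^ 2 + s ^ 2) * ∫ t in Set.Ioi (0 : ℝ),
      Real.exp (-(m * √(‖v‖ ^ 2 + s ^ 2)) * Real.cosh t) * Real.cosh (2 * t) : ℝ) : ℂ) := by
  set F : E3 → ℝ → ℝ := fun p u => Real.exp (-(1 / 2) * u) *
    Real.exp (-(s ^ 2 / 4) * Real.exp (-u) - omega m p ^ 2 * Real.exp u) with hF
  have hF0 : ∀ p u, 0 ≤ F p u := fun p u => by positivity
  have hL := fun p : E3 => integral_levy hs (omega_pos hm p)
  have hc : 0 < 2 * √π / s := by positivity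
  have hω := continuous_omega m
  -- Fubini applies because the Fourier phase has modulus one: integrating the positive `F` over `u`
  -- returns a multiple of `e^{-sω}`, which is integrable in `p`.
  have hint : Integrable (Function.uncurry fun (p : E3) (u : ℝ) =>
      Complex.exp (Complex.I * (inner ℝ v p : ℝ)) * ((F p u : ℝ) : ℂ))
      ((volume : Measure E3).prod (volume : Measure ℝ)) := by
    have hcont : Continuous (Function.uncurry fun (p : E3) (u : ℝ) =>
        Complex.exp (Complex.I * (inner ℝ v p : ℝ)) * ((F p u : ℝ) : ℂ)) := by
      simp only [hF, Function.uncurry_def]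
      have : Continuous fun x : E3 × ℝ => omega m x.1 := hω.comp continuous_fst
      fun_prop
    refine (integrable_prod_iff hcont.aestronglyMeasurable).2 ⟨ae_of_all _ fun p => ?_, ?_⟩
    · exact ((hL p).1.ofReal (𝕜 := ℂ)).const_mul (Complex.exp (Complex.I * (inner ℝ v p : ℝ)))
    · simp only [Function.uncurry_apply_pair, norm_mul, norm_cexp_I_mul_ofReal, one_mul,
        Complex.norm_real]
      have : ∀ p : E3, ∫ u, ‖F p u‖ = 2 * √π / s * Real.exp (-(s * omega m p)) := by
        intro p
        rw [← (hL p).2]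
        exact integral_congr_ae (ae_of_all _ fun u => Real.norm_of_nonneg (hF0 p u))
      simp_rw [this]
      exact (integrable_exp_neg_mul_omega hm hs).const_mul _
  have hstep : ∀ p : E3, Complex.exp (Complex.I * (inner ℝ v p : ℝ)) *
      ((Real.exp (-(s * omega m p)) : ℝ) : ℂ) = (((2 * √π / s)⁻¹ : ℝ) : ℂ) *
        ∫ u : ℝ, Complex.exp (Complex.I * (inner ℝ v p : ℝ)) * ((F p u : ℝ) : ℂ) := by
    intro p
    have h1 : ∫ u : ℝ, ((F p u : ℝ) : ℂ) =
        ((2 * √π / s * Real.exp (-(s * omega m p)) : ℝ) : ℂ) := by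
      rw [← (hL p).2]; exact integral_ofReal
    rw [integral_const_mul, h1, mul_left_comm, ← Complex.ofReal_mul, inv_mul_cancel_left₀ hc.ne']
  simp_rw [hstep]
  rw [integral_const_mul, integral_integral_swap hint]
  simp only [hF]
  simp_rw [integral_cexp_gaussian]
  have h2 := integral_exp_neg_two_mul_eq_besselK (r := √(‖v‖ ^ 2 + s ^ 2)) (m := m)
    (by positivity) hm
  rw [Real.sq_sqrt (by positivity)] at h2
  rw [show ∀ g : ℝ → ℝ, ∫ u, ((g u : ℝ) : ℂ) = ((∫ u, g u : ℝ) : ℂ) from fun g => integral_ofReal,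
    integral_const_mul, h2, ← Complex.ofReal_mul]
  congr 1
  have hπ : 0 < √π := by positivity
  field_simp
  ring

/-- On the negative imaginary axis `‖v‖² - t² = ‖v‖² + s²` is positive, so the root and the Bessel
integral are real and the subordination formula applies directly. -/
theorem timeKernel_neg_I_mul {m : ℝ} (hm : 0 < m) {s : ℝ} (hs : 0 < s) (v : E3) :
    timeKernel m (-Complex.I * s) v = (((2 * π) ^ 3)⁻¹ : ℝ) *
      ∫ p : E3, Complex.exp (Complex.I * (inner ℝ v p : ℝ)) *
        ((Real.exp (-(s * omega m p)) : ℝ) : ℂ) := by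
  rw [integral_cexp_mul_exp_neg_omega hm hs]
  have hz : (‖v‖ : ℂ) ^ 2 - (-Complex.I * s) ^ 2 = ((‖v‖ ^ 2 + s ^ 2 : ℝ) : ℂ) := by
    rw [mul_pow, neg_sq, Complex.I_sq]; push_cast; ring
  have hsq : Complex.sqrt ((‖v‖ ^ 2 + s ^ 2 : ℝ) : ℂ) = ((√(‖v‖ ^ 2 + s ^ 2) : ℝ) : ℂ) := by
    rw [Complex.sqrt_of_nonneg (by exact_mod_cast (by positivity : 0 ≤ ‖v‖ ^ 2 + s ^ 2)),
      Complex.ofReal_re]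
  unfold timeKernel
  rw [hz, hsq, ← Complex.ofReal_mul, besselK_two_ofReal]
  set J := ∫ t in Set.Ioi (0 : ℝ),
      Real.exp (-(m * √(‖v‖ ^ 2 + s ^ 2)) * Real.cosh t) * Real.cosh (2 * t)
  have h1 : Complex.I * (-Complex.I * s) = ((s : ℝ) : ℂ) := by
    rw [← mul_assoc, mul_neg, Complex.I_mul_I]; ring
  rw [h1]
  norm_cast
  have : 0 < ‖v‖ ^ 2 + s ^ 2 := by positivity
  field_simp
  ring

/-- The time kernel is the Fourier transform of `e^{-iωt}`. -/
theorem timeKernel_eq_integral {m : ℝ} (hm : 0 < m) {t : ℂ} (ht : t.im < 0) (v : E3) :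
    timeKernel m t v = (((2 * π) ^ 3)⁻¹ : ℝ) *
      ∫ p : E3, Complex.exp (Complex.I * (inner ℝ v p : ℝ)) *
        Complex.exp (-(Complex.I * t * omega m p)) := by
  have hopen : IsOpen {t : ℂ | t.im < 0} := isOpen_lt Complex.continuous_im continuous_const
  have hω := continuous_omega m
  have hA : AnalyticOnNhd ℂ (fun t => timeKernel m t v) {t : ℂ | t.im < 0} := by
    refine DifferentiableOn.analyticOnNhd (fun t ht => ?_) hopen
    exact (differentiableAt_timeKernel hm
      (sq_sub_sq_mem_slitPlane ht _)).differentiableWithinAt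
  have hB : AnalyticOnNhd ℂ (fun t => (((2 * π) ^ 3)⁻¹ : ℝ) *
      ∫ p : E3, Complex.exp (Complex.I * (inner ℝ v p : ℝ)) *
        Complex.exp (-(Complex.I * t * omega m p))) {t : ℂ | t.im < 0} := by
    refine DifferentiableOn.analyticOnNhd (DifferentiableOn.const_mul ?_ _) hopen
    have h := differentiableOn_laplace (μ := (volume : Measure E3)) (a := omega m)
      (b := fun p => Complex.exp (Complex.I * (inner ℝ v p : ℝ)))
      hω.measurable (fun p => (omega_pos hm p).le) (by fun_prop) (fun δ hδ => by
        refine (integrable_exp_neg_mul_omega hm hδ).mono (by fun_prop) (ae_of_all _ fun p => ?_)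
        rw [norm_mul, norm_cexp_I_mul_ofReal, one_mul, Complex.norm_real])
    refine h.comp (f := fun t : ℂ => Complex.I * t) (by fun_prop) fun t ht => ?_
    simpa using ht
  -- Identity theorem: both sides agree on the points `-is`, which accumulate at `-i` as `s`
  -- decreases to 1.
  refine hA.eqOn_of_preconnected_of_frequently_eq hB (convex_halfSpace_im_lt 0).isPreconnected
    (z₀ := -Complex.I) (by simp) ?_ ht
  have hseq : Tendsto (fun s : ℝ => -Complex.I * (s : ℂ)) (𝓝[>] 1) (𝓝[≠] (-Complex.I)) := by
    refine tendsto_nhdsWithin_iff.2 ⟨?_, ?_⟩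
    · have : Tendsto (fun s : ℝ => -Complex.I * (s : ℂ)) (𝓝 1) (𝓝 (-Complex.I * ((1 : ℝ) : ℂ))) :=
        (by fun_prop : Continuous fun s : ℝ => -Complex.I * (s : ℂ)).tendsto 1
      simp only [Complex.ofReal_one, mul_one] at this
      exact this.mono_left nhdsWithin_le_nhds
    · filter_upwards [self_mem_nhdsWithin] with s hs h
      simp only [Set.mem_singleton_iff] at h
      have h2 : (s : ℂ) = 1 := mul_left_cancel₀ (neg_ne_zero.2 Complex.I_ne_zero) (by simpa using h)
      have h3 : s = 1 := by exact_mod_cast h2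
      exact (ne_of_gt hs) h3
  refine hseq.frequently (Eventually.frequently ?_)
  filter_upwards [self_mem_nhdsWithin] with s hs
  rw [timeKernel_neg_I_mul hm (zero_lt_one.trans hs)]
  congr 2; ext p
  push_cast
  congr 2
  rw [← mul_assoc, mul_neg, Complex.I_mul_I]; ring

/-- The inverse Fourier transform of the time kernel. -/
theorem integral_timeKernel_mul_cexp {m : ℝ} (hm : 0 < m) {t : ℂ} (ht : t.im < 0) (p : E3) :
    ∫ v : E3, timeKernel m t v * Complex.exp (-(Complex.I * (inner ℝ p v : ℝ))) =
      Complex.exp (-(Complex.I * t * omega m p)) := by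
  have hω := continuous_omega m
  set f : E3 → ℂ := fun p => Complex.exp (-(Complex.I * t * omega m p)) with hf
  have hfc : Continuous f := by fun_prop
  have hfi : Integrable f := by
    refine (integrable_exp_neg_mul_omega hm (neg_pos.2 ht)).mono hfc.aestronglyMeasurable
      (ae_of_all _ fun p => ?_)
    rw [hf, Complex.norm_exp, Real.norm_of_nonneg (Real.exp_pos _).le]
    simp
  have h2π : (0 : ℝ) < 2 * π := by positivity
  have hinv : ∀ w : E3, FourierTransformInv.fourierInv f w =
      (((2 * π) ^ 3 : ℝ) : ℂ) * timeKernel m t ((2 * π) • w) := by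
    intro w
    rw [timeKernel_eq_integral hm ht, ← mul_assoc, ← Complex.ofReal_mul,
      mul_inv_cancel₀ (by positivity), Complex.ofReal_one, one_mul, Real.fourierInv_eq']
    congr 1; ext q
    rw [smul_eq_mul, real_inner_smul_left, real_inner_comm]
    congr 2
    push_cast; ring
  have hKi : Integrable fun w : E3 => (((2 * π) ^ 3 : ℝ) : ℂ) * timeKernel m t ((2 * π) • w) :=
    ((integrable_timeKernel hm ht).comp_smul h2π.ne').const_mul _
  -- Fourier inversion needs the transform itself to be integrable. It is a rescaled kernel, so the
  -- decay of `K₂` supplies this.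
  have hF : Integrable (FourierTransform.fourier f) := by
    have h1 : FourierTransform.fourier f = fun w : E3 => FourierTransformInv.fourierInv f (-w) := by
      ext w
      rw [Real.fourierInv_eq_fourier_neg, neg_neg]
    rw [h1]
    simp_rw [hinv]
    exact hKi.comp_neg
  have h := congrFun (hfc.fourier_fourierInv_eq hfi hF) p
  rw [Real.fourier_eq'] at h
  simp_rw [hinv] at h
  refine Eq.trans ?_ h
  -- `G` is kept opaque so that the dilation `v = 2πw` acts on the integrand as a whole; its
  -- Jacobian `(2π)⁻³` cancels the prefactor.
  obtain ⟨G, hG⟩ : ∃ G : E3 → ℂ, G = fun v : E3 => timeKernel m t v *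
      Complex.exp (-(Complex.I * (inner ℝ p v : ℝ))) := ⟨_, rfl⟩
  rw [← hG]
  have hrw : ∀ w : E3, Complex.exp (((-2 * π * inner ℝ w p : ℝ) : ℂ) * Complex.I) •
      ((((2 * π) ^ 3 : ℝ) : ℂ) * timeKernel m t ((2 * π) • w)) =
      (((2 * π) ^ 3 : ℝ) : ℂ) * G ((2 * π) • w) := by
    intro w
    rw [hG, smul_eq_mul]
    simp only
    rw [real_inner_smul_right, real_inner_comm, mul_comm (Complex.exp _), mul_assoc]
    congr 3
    push_cast; ring
  simp_rw [hrw]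
  rw [integral_const_mul, Measure.integral_comp_smul, finrank_euclideanSpace, Fintype.card_fin,
    abs_of_pos (by positivity), Complex.real_smul, ← mul_assoc, ← Complex.ofReal_mul,
    mul_inv_cancel₀ (by positivity), Complex.ofReal_one, one_mul]

/-! ### The limit kernel at space-like separation -/

/-- In the space-like region the time kernel at real time is approached locally uniformly from
the lower half-plane. -/
theorem tendstoLocallyUniformlyOn_timeKernel {m : ℝ} (hm : 0 < m) (τ : ℝ) :
    TendstoLocallyUniformlyOn
      (fun (ε : ℝ) (v : E3) => timeKernel m (τ - ε * Complex.I) v)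
      (fun v => timeKernel m τ v) (𝓝[>] 0) {v | |τ| < ‖v‖} := by
  rw [Metric.tendstoLocallyUniformlyOn_iff]
  intro e he v hv
  simp only [Set.mem_ofPred_eq] at hv
  have hsp : (‖v‖ : ℂ) ^ 2 - (τ : ℂ) ^ 2 ∈ Complex.slitPlane := by
    rw [← Complex.ofReal_pow, ← Complex.ofReal_pow, ← Complex.ofReal_sub,
      Complex.ofReal_mem_slitPlane]
    have := pow_lt_pow_left₀ hv (abs_nonneg τ) two_ne_zero
    rw [sq_abs] at this
    linarith
  have hc := continuousAt_timeKernel hm (q := ((τ : ℂ), v)) hsp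
  have hφ : ContinuousAt (fun x : ℝ × E3 => timeKernel m (τ - x.1 * Complex.I) x.2) (0, v) := by
    refine ContinuousAt.comp (g := fun q : ℂ × E3 => timeKernel m q.1 q.2)
      (f := fun x : ℝ × E3 => ((τ : ℂ) - x.1 * Complex.I, x.2)) ?_ (by fun_prop)
    simpa using hc
  have hnear := Metric.continuousAt_iff'.1 hφ (e / 2) (by positivity)
  rw [nhds_prod_eq] at hnear
  obtain ⟨P, hP, Q, hQ, hPQ⟩ := eventually_prod_iff.1 hnear
  refine ⟨{w | Q w}, mem_nhdsWithin_of_mem_nhds hQ, ?_⟩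
  filter_upwards [nhdsWithin_le_nhds hP] with ε hε w hw
  have h1 := hPQ hε hw
  -- The neighbourhood of `ε = 0` is two-sided and contains 0, so the same estimate also covers the
  -- limit function at `w`.
  have h2 := hPQ hP.self_of_nhds hw
  simp only [Complex.ofReal_zero, zero_mul, sub_zero] at h1 h2
  calc dist (timeKernel m τ w) (timeKernel m (τ - ε * Complex.I) w)
      ≤ dist (timeKernel m τ w) (timeKernel m τ v) +
        dist (timeKernel m (τ - ε * Complex.I) w) (timeKernel m τ v) :=
        dist_triangle_right _ _ _
    _ < e := by linarith

/-! ### Annihilation operators on the Schwartz core -/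

theorem integrable_shellMeasure_inv_one_add_norm_pow_four {m : ℝ} (hm : 0 < m) :
    Integrable (fun p : E3 => ((1 + ‖p‖) ^ 4)⁻¹) (shellMeasure m) := by
  refine integrable_inv_one_add_norm_pow_four.of_measure_le_smul
    (c := ENNReal.ofReal (1 / (2 * m))) ENNReal.ofReal_ne_top ?_
  unfold shellMeasure
  rw [← withDensity_const]
  refine withDensity_mono (ae_of_all _ fun p => ENNReal.ofReal_le_ofReal ?_)
  have := le_omega hm p
  gcongr

/-- A Schwartz function of several momenta is dominated by a product of one-particle weights. -/
theorem exists_norm_le_prod {k : ℕ} (g : SchwartzMap (Fin k → E3) ℂ) (n : ℕ) :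
    ∃ A : ℝ, 0 ≤ A ∧ ∀ p, ‖g p‖ ≤ A * ∏ j, ((1 + ‖p j‖) ^ n)⁻¹ := by
  refine ⟨2 ^ (n * k) * (Finset.Iic (n * k, 0)).sup
    (fun m => SchwartzMap.seminorm ℂ m.1 m.2) g, by positivity, fun p => ?_⟩
  have h := SchwartzMap.one_add_le_sup_seminorm_apply (𝕜 := ℂ) (m := (n * k, 0))
    (le_refl (n * k)) (le_refl 0) g p
  rw [norm_iteratedFDeriv_zero] at h
  have h1 : ∏ j, (1 + ‖p j‖) ^ n ≤ (1 + ‖p‖) ^ (n * k) := by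
    calc ∏ j, (1 + ‖p j‖) ^ n ≤ ∏ _j : Fin k, (1 + ‖p‖) ^ n := by
          refine Finset.prod_le_prod (fun j _ => by positivity) fun j _ => ?_
          gcongr
          exact norm_le_pi_norm p j
      _ = _ := by rw [Finset.prod_const, Finset.card_univ, Fintype.card_fin, pow_mul]
  have h2 : 0 < ∏ j, (1 + ‖p j‖) ^ n := Finset.prod_pos fun j _ => by positivity
  rw [Finset.prod_inv_distrib, ← div_eq_mul_inv, le_div_iff₀ h2, mul_comm]
  exact (mul_le_mul_of_nonneg_right h1 (norm_nonneg _)).trans h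

/-- The product lies between 0 and 1, so its square is at most itself, and it is integrable as a
product of integrable one-particle factors. -/
theorem memLp_prod_inv_one_add_norm_pow_four {m : ℝ} (hm : 0 < m) (k : ℕ) :
    MemLp (fun q : Fin k → E3 => ∏ j, ((1 + ‖q j‖) ^ 4)⁻¹) 2 (shellMeasurePi m k) := by
  have hc : Continuous fun q : Fin k → E3 => ∏ j, ((1 + ‖q j‖) ^ 4)⁻¹ := by
    refine continuous_finsetProd _ fun j _ => ?_
    exact Continuous.inv₀ (by fun_prop) fun q => by positivity
  have hi : Integrable (fun q : Fin k → E3 => ∏ j, ((1 + ‖q j‖) ^ 4)⁻¹) (shellMeasurePi m k) :=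
    Integrable.fintype_prod (f := fun (_ : Fin k) (p : E3) => ((1 + ‖p‖) ^ 4)⁻¹)
      fun _ => integrable_shellMeasure_inv_one_add_norm_pow_four hm
  rw [memLp_two_iff_integrable_sq_norm hc.aestronglyMeasurable]
  refine hi.mono' (hc.norm.pow 2).aestronglyMeasurable (ae_of_all _ fun q => ?_)
  have h0 : 0 ≤ ∏ j, ((1 + ‖q j‖) ^ 4)⁻¹ := Finset.prod_nonneg fun j _ => by positivity
  have h1 : ∏ j, ((1 + ‖q j‖) ^ 4)⁻¹ ≤ 1 := by
    refine Finset.prod_le_one (fun j _ => by positivity) fun j _ => ?_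
    exact inv_le_one_of_one_le₀ (one_le_pow₀ (by linarith [norm_nonneg (q j)]))
  rw [Real.norm_of_nonneg (by positivity), Real.norm_of_nonneg h0]
  nlinarith

theorem continuous_cons {k : ℕ} : Continuous fun x : (Fin k → E3) × E3 =>
    (Fin.cons x.2 x.1 : Fin (k + 1) → E3) :=
  Continuous.finCons (A := fun _ => E3) continuous_snd continuous_fst

/-- A permutation of the remaining momenta extends to one that fixes the integrated momentum.
Symmetry of the contraction thus follows from symmetry before contraction. -/
theorem cons_comp_decomposeFin {α : Type*} {k : ℕ} (σ : Equiv.Perm (Fin k)) (p : α)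
    (q : Fin k → α) :
    (Fin.cons p q : Fin (k + 1) → α) ∘ Equiv.Perm.decomposeFin.symm (0, σ) =
      Fin.cons p (q ∘ σ) := by
  ext i
  refine Fin.cases ?_ (fun j => ?_) i
  · simp
  · simp

/-- Contraction of a symmetric Schwartz wave function with weighted bounded functions of one
momentum is bounded from the uniform norm to `L²`. -/
theorem exists_contraction {m : ℝ} (hm : 0 < m) {u : E3 → ℂ} (hu : Continuous u) {C : ℝ}
    (hC : ∀ p, ‖u p‖ ≤ C * (1 + ‖p‖) ^ 2) {k : ℕ} (ψ : symmSpace m (k + 1))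
    (g : SchwartzMap (Fin (k + 1) → E3) ℂ)
    (hg : ((ψ : Lp ℂ 2 (shellMeasurePi m (k + 1))) : (Fin (k + 1) → E3) → ℂ)
      =ᵐ[shellMeasurePi m (k + 1)] g) :
    ∃ T : BoundedContinuousFunction E3 ℂ →L[ℂ] symmSpace m k, ∀ f,
      ∀ᵐ q ∂(shellMeasurePi m k),
        Integrable (fun p => f p * u p *
          (ψ : Lp ℂ 2 (shellMeasurePi m (k + 1))) (Fin.cons p q)) (shellMeasure m) ∧
        ((T f : symmSpace m k) : Lp ℂ 2 (shellMeasurePi m k)) q = (√((k : ℝ) + 1) : ℂ) *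
          ∫ p, f p * u p *
            (ψ : Lp ℂ 2 (shellMeasurePi m (k + 1))) (Fin.cons p q) ∂(shellMeasure m) := by
  -- Of the six powers, two absorb the growth of `u` and four remain for integrability in `p`.
  obtain ⟨A, hA0, hA⟩ := exists_norm_le_prod g 6
  have hC0 : 0 ≤ C := by
    have := (norm_nonneg _).trans (hC 0)
    simpa using this
  set b : E3 → ℝ := fun p => ((1 + ‖p‖) ^ 4)⁻¹ with hb
  set B : (Fin k → E3) → ℝ := fun q => ∏ j, ((1 + ‖q j‖) ^ 4)⁻¹ with hB
  have hB0 : ∀ q, 0 ≤ B q := fun q => Finset.prod_nonneg fun j _ => by positivity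
  have hbi : Integrable b (shellMeasure m) :=
    integrable_shellMeasure_inv_one_add_norm_pow_four hm
  have hbound : ∀ (f : BoundedContinuousFunction E3 ℂ) (q : Fin k → E3) (p : E3),
      ‖f p * u p * g (Fin.cons p q)‖ ≤ (‖f‖ * (C * A) * B q) * b p := by
    intro f q p
    rw [norm_mul, norm_mul]
    have h1 : ‖g (Fin.cons p q)‖ ≤ A * (((1 + ‖p‖) ^ 6)⁻¹ * B q) := by
      refine (hA _).trans ?_
      rw [Fin.prod_univ_succ]
      simp only [Fin.cons_zero, Fin.cons_succ, hB]
      gcongr ?_ * (_ * ?_)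
      refine Finset.prod_le_prod (fun j _ => by positivity) fun j _ => ?_
      gcongr
      · linarith [norm_nonneg (q j)]
      · norm_num
    calc ‖f p‖ * ‖u p‖ * ‖g (Fin.cons p q)‖
        ≤ ‖f‖ * (C * (1 + ‖p‖) ^ 2) * (A * (((1 + ‖p‖) ^ 6)⁻¹ * B q)) := by
          have h2 := f.norm_coe_le_norm p
          have h3 := hC p
          gcongr
      _ = _ := by
          simp only [hb]
          have : 0 < 1 + ‖p‖ := by positivity
          field_simp
  have hcont : ∀ f : BoundedContinuousFunction E3 ℂ, Continuous
      (Function.uncurry fun (q : Fin k → E3) (p : E3) => f p * u p * g (Fin.cons p q)) := by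
    intro f
    exact ((f.continuous.comp continuous_snd).mul (hu.comp continuous_snd)).mul
      (g.continuous.comp continuous_cons)
  have hint : ∀ (f : BoundedContinuousFunction E3 ℂ) (q : Fin k → E3),
      Integrable (fun p => f p * u p * g (Fin.cons p q)) (shellMeasure m) := by
    intro f q
    refine (hbi.const_mul (‖f‖ * (C * A) * B q)).mono' ?_ (ae_of_all _ (hbound f q))
    exact ((hcont f).comp (by fun_prop : Continuous fun p : E3 => (q, p))).aestronglyMeasurable
  set h : BoundedContinuousFunction E3 ℂ → (Fin k → E3) → ℂ := fun f q =>
    (√((k : ℝ) + 1) : ℂ) * ∫ p, f p * u p * g (Fin.cons p q) ∂(shellMeasure m) with hh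
  set D : ℝ := √((k : ℝ) + 1) * (C * A * ∫ p, b p ∂(shellMeasure m)) with hD
  have hhb : ∀ f q, ‖h f q‖ ≤ D * ‖f‖ * ‖B q‖ := by
    intro f q
    rw [hh, norm_mul, Complex.norm_real, Real.norm_of_nonneg (by positivity),
      Real.norm_of_nonneg (hB0 q)]
    have h1 := norm_integral_le_of_norm_le (hbi.const_mul (‖f‖ * (C * A) * B q))
      (ae_of_all _ (hbound f q))
    rw [integral_const_mul] at h1
    refine (mul_le_mul_of_nonneg_left h1 (by positivity)).trans (le_of_eq ?_)
    rw [hD]; ring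
  have hBL : MemLp B 2 (shellMeasurePi m k) := memLp_prod_inv_one_add_norm_pow_four hm k
  have hhL : ∀ f, MemLp (h f) 2 (shellMeasurePi m k) := by
    intro f
    refine hBL.of_le_mul (c := D * ‖f‖) ?_ (ae_of_all _ (hhb f))
    exact ((hcont f).stronglyMeasurable.integral_prod_right.aestronglyMeasurable).const_mul _
  have hsymm : ∀ f, (hhL f).toLp ∈ symmSpace m k := by
    intro f σ
    have h1 := (hhL f).coeFn_toLp
    have h2 : (fun p => g (p ∘ Equiv.Perm.decomposeFin.symm (0, σ)))
        =ᵐ[shellMeasurePi m (k + 1)] g := by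
      filter_upwards [hg, ψ.2 (Equiv.Perm.decomposeFin.symm (0, σ)),
        (measurePreserving_perm m (Equiv.Perm.decomposeFin.symm (0, σ))).quasiMeasurePreserving.ae
          hg] with x h1 h2 h3
      rw [← h3, h2, h1]
    filter_upwards [h1, (measurePreserving_perm m σ).quasiMeasurePreserving.ae h1,
      ae_ae_cons m h2] with q hq1 hq2 hq3
    rw [hq1, hq2, hh]
    simp only
    congr 1
    refine integral_congr_ae ?_
    filter_upwards [hq3] with p hp
    rw [cons_comp_decomposeFin] at hp
    rw [hp]
  let T₀ : BoundedContinuousFunction E3 ℂ →ₗ[ℂ] symmSpace m k :=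
    { toFun := fun f => ⟨(hhL f).toLp, hsymm f⟩
      map_add' := by
        intro f₁ f₂
        apply Subtype.ext
        change (hhL (f₁ + f₂)).toLp = (hhL f₁).toLp + (hhL f₂).toLp
        rw [← MemLp.toLp_add]
        refine MemLp.toLp_congr _ _ (ae_of_all _ fun q => ?_)
        simp only [hh, Pi.add_apply]
        rw [← mul_add, ← integral_add (hint f₁ q) (hint f₂ q)]
        congr 1
        refine integral_congr_ae (ae_of_all _ fun p => ?_)
        simp only [BoundedContinuousFunction.add_apply]
        ring
      map_smul' := by
        intro a f
        apply Subtype.ext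
        change (hhL (a • f)).toLp = a • (hhL f).toLp
        rw [← MemLp.toLp_const_smul]
        refine MemLp.toLp_congr _ _ (ae_of_all _ fun q => ?_)
        simp only [hh, Pi.smul_apply, smul_eq_mul]
        rw [mul_left_comm, ← integral_const_mul a]
        congr 1
        refine integral_congr_ae (ae_of_all _ fun p => ?_)
        simp only [BoundedContinuousFunction.smul_apply, smul_eq_mul]
        ring }
  have hT : ∀ f, ‖T₀ f‖ ≤ (D * ‖hBL.toLp‖) * ‖f‖ := by
    intro f
    change ‖(hhL f).toLp‖ ≤ _
    have := Lp.norm_le_mul_norm_of_ae_le_mul (f := (hhL f).toLp) (g := hBL.toLp) (c := D * ‖f‖) (by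
      filter_upwards [(hhL f).coeFn_toLp, hBL.coeFn_toLp] with q h1 h2
      rw [h1, h2]
      exact hhb f q)
    linarith
  refine ⟨T₀.mkContinuous _ hT, fun f => ?_⟩
  filter_upwards [(hhL f).coeFn_toLp, ae_ae_cons m hg] with q h1 h2
  have h3 : (fun p => f p * u p * (ψ : Lp ℂ 2 (shellMeasurePi m (k + 1))) (Fin.cons p q))
      =ᵐ[shellMeasure m] fun p => f p * u p * g (Fin.cons p q) := by
    filter_upwards [h2] with p hp
    rw [hp]
  refine ⟨(integrable_congr h3).2 (hint f q), ?_⟩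
  rw [integral_congr_ae h3]
  exact h1

/-- On a fixed vector of the Schwartz core, a weighted annihilation operator depends continuously
on its coefficient function. -/
theorem exists_annihilation_clm {m : ℝ} (hm : 0 < m) {u : E3 → ℂ} (hu : Continuous u) {C : ℝ}
    (hC : ∀ p, ‖u p‖ ≤ C * (1 + ‖p‖) ^ 2) {Ψ : Fock m} (hΨ : Ψ ∈ schwartzCore m) :
    ∃ T : BoundedContinuousFunction E3 ℂ →L[ℂ] Fock m, ∀ f,
      (Ψ, T f) ∈ annihilationGraph m (fun p => f p * u p) := by
  obtain ⟨⟨N, hN⟩, hS⟩ := hΨ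
  choose g hg using hS
  choose T hT using fun k => exists_contraction hm hu hC (Ψ (k + 1)) (g (k + 1)) (hg (k + 1))
  have hT0 : ∀ k, N ≤ k → ∀ f, T k f = 0 := by
    intro k hk f
    apply Subtype.ext
    refine Lp.ext (EventuallyEq.trans ?_ (Lp.coeFn_zero ℂ 2 (shellMeasurePi m k)).symm)
    have h0 : (((Ψ (k + 1) : symmSpace m (k + 1)) : Lp ℂ 2 (shellMeasurePi m (k + 1))) :
        (Fin (k + 1) → E3) → ℂ) =ᵐ[shellMeasurePi m (k + 1)] 0 := by
      rw [hN (k + 1) (by omega)]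
      exact Lp.coeFn_zero _ _ _
    filter_upwards [hT k f, ae_ae_cons m h0] with q h1 h2
    have h3 : (fun p => f p * u p * ((Ψ (k + 1) : symmSpace m (k + 1)) :
        Lp ℂ 2 (shellMeasurePi m (k + 1))) (Fin.cons p q)) =ᵐ[shellMeasure m] fun _ => 0 := by
      filter_upwards [h2] with p hp
      rw [hp, Pi.zero_apply, mul_zero]
    rw [h1.2, integral_congr_ae h3]
    simp
  -- Component `k` of the result depends only on component `k + 1` of `Ψ`, which vanishes for `k ≥
  -- N`; a finite sum therefore suffices.
  refine ⟨∑ k ∈ Finset.range N,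
    (lp.singleContinuousLinearMap ℂ (fun k : ℕ => symmSpace m k) 2 k) ∘L T k, fun f k => ?_⟩
  have hk : (∑ k ∈ Finset.range N,
      (lp.singleContinuousLinearMap ℂ (fun k : ℕ => symmSpace m k) 2 k) ∘L T k) f k = T k f := by
    rw [_root_.sum_apply]
    simp only [ContinuousLinearMap.comp_apply, lp.singleContinuousLinearMap_apply, lp.coeFn_sum,
      Finset.sum_apply, lp.coeFn_single, Finset.sum_pi_single, Finset.mem_range]
    split_ifs with h
    · rfl
    · exact (hT0 k (not_lt.1 h) f).symm
  simp only [Fock.wave, hk]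
  exact hT k f

/-! ### Covariance under rotations and translations -/

theorem mem_conjugate_graph {m : ℝ} (V : Fock m ≃ₗᵢ[ℂ] Fock m) (A : Fock m →ₗ.[ℂ] Fock m)
    (X : Fock m × Fock m) :
    X ∈ (conjugate V A).graph ↔ (V.symm X.1, V.symm X.2) ∈ A.graph := by
  rw [LinearPMap.mem_graph_iff, LinearPMap.mem_graph_iff]
  constructor
  · rintro ⟨Ψ, h1, h2⟩
    refine ⟨⟨V.symm Ψ, Ψ.2⟩, by rw [← h1], ?_⟩
    rw [← h2, conjugate_apply, LinearIsometryEquiv.symm_apply_apply]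
  · rintro ⟨Ψ, h1, h2⟩
    refine ⟨⟨X.1, ?_⟩, rfl, ?_⟩
    · change V.symm X.1 ∈ A.domain
      simp only at h1
      rw [← h1]; exact Ψ.2
    · rw [conjugate_apply]
      have h3 : (⟨V.symm X.1, by simp only at h1; rw [← h1]; exact Ψ.2⟩ : A.domain) = Ψ :=
        Subtype.ext h1.symm
      simp only [h3, h2, LinearIsometryEquiv.apply_symm_apply]

theorem phase_cons (m : ℝ) (y : SpaceTime) {k : ℕ} (p : E3) (q : Fin k → E3) :
    phase m y (Fin.cons p q : Fin (k + 1) → E3) =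
      Complex.exp (Complex.I * (shellDot m p y : ℝ)) * phase m y q := by
  unfold phase
  rw [Fin.sum_univ_succ, ← Complex.exp_add, ← mul_add, ← Complex.ofReal_add]
  simp

theorem phase_ne_zero (m : ℝ) (y : SpaceTime) {k : ℕ} (p : Fin k → E3) : phase m y p ≠ 0 :=
  norm_ne_zero_iff.1 (by rw [norm_phase]; exact one_ne_zero)

theorem cons_comp_isometry (e : E3 → E3) {k : ℕ} (p : E3) (q : Fin k → E3) :
    (fun j => e ((Fin.cons p q : Fin (k + 1) → E3) j)) = Fin.cons (e p) (fun j => e (q j)) := by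
  ext1 j
  refine Fin.cases ?_ (fun i => ?_) j <;> simp

/-- Covariance of the smeared annihilation operators. -/
theorem U_mem_annihilationGraph {m : ℝ} (y : SpaceTime)
    (R : Matrix.specialOrthogonalGroup (Fin 3) ℝ) {c c' : E3 → ℂ}
    (hc : ∀ p, c' p * Complex.exp (Complex.I * (shellDot m p y : ℝ)) = c ((rot R).symm p))
    (X : Fock m × Fock m) :
    (U m y R X.1, U m y R X.2) ∈ annihilationGraph m c' ↔ X ∈ annihilationGraph m c := by
  refine forall_congr' fun k => ?_
  set S : (Fin k → E3) → Prop := fun q =>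
    Integrable (fun p => c p * X.1.wave (k + 1) (Fin.cons p q)) (shellMeasure m) ∧
    X.2.wave k q = (√((k : ℝ) + 1) : ℂ) *
      ∫ p, c p * X.1.wave (k + 1) (Fin.cons p q) ∂(shellMeasure m) with hS
  have hmp := measurePreserving_isometry m (rot R).symm
  have hemb : MeasurableEmbedding (rot R).symm :=
    (rot R).symm.toHomeomorph.measurableEmbedding
  -- The condition on the transformed pair at `q` is the original one at `R⁻¹q`. The phase of the
  -- spectator momenta is a nonzero factor on both sides and cancels; that of the integrated
  -- momentum is absorbed by `hc`, and the rotation by invariance of the measure.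
  have hkey : ∀ᵐ q ∂(shellMeasurePi m k),
      ((Integrable (fun p => c' p * (U m y R X.1).wave (k + 1) (Fin.cons p q)) (shellMeasure m) ∧
      (U m y R X.2).wave k q = (√((k : ℝ) + 1) : ℂ) *
        ∫ p, c' p * (U m y R X.1).wave (k + 1) (Fin.cons p q) ∂(shellMeasure m)) ↔
      S (fun j => (rot R).symm (q j))) := by
    filter_upwards [U_wave m y R X.2 k, ae_ae_cons m (U_wave m y R X.1 (k + 1))] with q h1 h2
    set F : E3 → ℂ := fun p =>
      c p * X.1.wave (k + 1) (Fin.cons p fun j => (rot R).symm (q j)) with hF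
    have h3 : (fun p => c' p * (U m y R X.1).wave (k + 1) (Fin.cons p q)) =ᵐ[shellMeasure m]
        fun p => phase m y q * (F ∘ (rot R).symm) p := by
      filter_upwards [h2] with p hp
      rw [hp, phase_cons, cons_comp_isometry, hF, Function.comp_apply, ← hc]
      ring
    rw [integrable_congr h3, integral_congr_ae h3, integral_const_mul, h1,
      integrable_const_mul_iff (IsUnit.mk0 _ (phase_ne_zero m y q)),
      hmp.integrable_comp_emb hemb]
    have h4 : ∫ p, (F ∘ (rot R).symm) p ∂(shellMeasure m) = ∫ p, F p ∂(shellMeasure m) :=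
      hmp.integral_comp hemb F
    rw [h4, mul_left_comm, mul_right_inj' (phase_ne_zero m y q)]
  change (∀ᵐ q ∂(shellMeasurePi m k), _) ↔ ∀ᵐ q ∂(shellMeasurePi m k), S q
  rw [eventually_congr hkey]
  constructor
  · intro h
    have := (measurePreserving_rotPi m (rot R) k).quasiMeasurePreserving.ae h
    simpa using this
  · intro h
    exact (measurePreserving_rotPi m (rot R).symm k).quasiMeasurePreserving.ae h

theorem conj_localizedWave (m : ℝ) (x : SpaceTime) (p : E3) :
    (starRingEnd ℂ) (localizedWave m x p) = (((2 * π) ^ (-(3 / 2) : ℝ) : ℝ) : ℂ) *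
      Complex.exp (-(Complex.I * (shellDot m p x : ℝ))) * (√(2 * omega m p) : ℝ) := by
  unfold localizedWave
  rw [map_mul, map_mul, ← Complex.exp_conj, map_mul, Complex.conj_ofReal, Complex.conj_ofReal,
    Complex.conj_I, Complex.conj_ofReal, neg_mul]

/-- Equality of graphs yields equality of domains as well. The coefficient identity holds because
`ω` is rotation invariant and `𝐩·R𝐱 = R⁻¹𝐩·𝐱`. -/
theorem conjugate_phi1 (m : ℝ) (y : SpaceTime) (R : Matrix.specialOrthogonalGroup (Fin 3) ℝ)
    (x : SpaceTime) :
    conjugate (U m y R) (phi1 m x) = phi1 m (x.1 + y.1, rot R x.2 + y.2) := by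
  refine LinearPMap.eq_of_eq_graph ?_
  ext X
  rw [mem_conjugate_graph]
  unfold phi1
  rw [annihilation_graph, annihilation_graph, ← U_mem_annihilationGraph y R
    (c' := fun p => (starRingEnd ℂ) (localizedWave m (x.1 + y.1, rot R x.2 + y.2) p))]
  · simp
  · intro p
    simp only [conj_localizedWave, omega_isometry]
    rw [mul_right_comm, mul_assoc (_ : ℂ) (Complex.exp _) (Complex.exp _), ← Complex.exp_add]
    congr 3
    have h1 : inner ℝ p (rot R x.2) = inner ℝ ((rot R).symm p) x.2 := by
      rw [← LinearIsometryEquiv.inner_map_map (rot R) ((rot R).symm p) x.2,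
        LinearIsometryEquiv.apply_symm_apply]
    simp only [shellDot, omega_isometry, inner_add_right, h1]
    push_cast
    ring

/-! ### Plane waves and the convolution formula -/

/-- The factor `2ω` compensating the shell density and the `1/√(2ω)` in `a` combine to the `√(2ω)`
of the localized wave, while at time 0 the phase is purely spatial. -/
theorem aTilde_eq_phi1 {m : ℝ} (hm : 0 < m) (x : E3) : aTilde m x = phi1 m (0, x) := by
  unfold aTilde phi1 annihilationNC
  congr 1
  ext p
  rw [conj_localizedWave]
  have hω := omega_pos hm p
  have h1 : ((2 * omega m p : ℝ) : ℂ) = (√(2 * omega m p) : ℝ) * (√(2 * omega m p) : ℝ) := by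
    rw [← Complex.ofReal_mul, Real.mul_self_sqrt (by positivity)]
  have h2 : ((√(2 * omega m p) : ℝ) : ℂ) ≠ 0 :=
    Complex.ofReal_ne_zero.2 (Real.sqrt_pos.2 (by positivity)).ne'
  have h3 : -(Complex.I * (shellDot m p (0, x) : ℝ)) = Complex.I * (inner ℝ p x : ℝ) := by
    simp [shellDot]
  rw [h1, h3]
  field_simp

theorem norm_cexp_sub_mul_omega (m : ℝ) (t : ℂ) (z p : E3) :
    ‖Complex.exp (Complex.I * ((inner ℝ p z : ℝ) - t * omega m p))‖ =
      Real.exp (t.im * omega m p) := by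
  rw [Complex.norm_exp]
  congr 1
  simp

theorem continuous_cexp_div_omega {m : ℝ} (hm : 0 < m) (t : ℂ) (z : E3) : Continuous fun p : E3 =>
    Complex.exp (Complex.I * ((inner ℝ p z : ℝ) - t * omega m p)) / (omega m p : ℂ) := by
  have hω := continuous_omega m
  exact Continuous.div (by fun_prop) (by fun_prop)
    fun p => Complex.ofReal_ne_zero.2 (omega_pos hm p).ne'

/-- The plane wave `e^{i(𝐩·𝐳 - tω)}/ω` at complex time `t` in the closed lower half-plane. -/
def planeWave {m : ℝ} (hm : 0 < m) (t : ℂ) (ht : t.im ≤ 0) (z : E3) :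
    BoundedContinuousFunction E3 ℂ :=
  BoundedContinuousFunction.ofNormedAddCommGroup _ (continuous_cexp_div_omega hm t z) m⁻¹ (by
    intro p
    have hω := omega_pos hm p
    rw [norm_div, norm_cexp_sub_mul_omega, Complex.norm_real, Real.norm_of_nonneg hω.le,
      div_eq_mul_inv]
    have h1 : Real.exp (t.im * omega m p) ≤ 1 :=
      Real.exp_le_one_iff.2 (mul_nonpos_of_nonpos_of_nonneg ht hω.le)
    have h2 : (omega m p)⁻¹ ≤ m⁻¹ := inv_anti₀ hm (le_omega hm p)
    calc _ ≤ 1 * m⁻¹ := by gcongr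
      _ = _ := one_mul _)

theorem planeWave_apply {m : ℝ} (hm : 0 < m) (t : ℂ) (ht : t.im ≤ 0) (z p : E3) :
    planeWave hm t ht z p =
      Complex.exp (Complex.I * ((inner ℝ p z : ℝ) - t * omega m p)) / (omega m p : ℂ) := rfl

theorem norm_planeWave_le {m : ℝ} (hm : 0 < m) (t : ℂ) (ht : t.im ≤ 0) (z : E3) :
    ‖planeWave hm t ht z‖ ≤ m⁻¹ :=
  BoundedContinuousFunction.norm_ofNormedAddCommGroup_le _ (by positivity) _

/-- The bare exponentials are not uniformly continuous in `z` over all momenta: their Lipschitz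
constant is `‖p‖`. Division by `ω ≥ ‖p‖` brings it down to 1. -/
theorem continuous_planeWave {m : ℝ} (hm : 0 < m) :
    Continuous fun z : E3 => planeWave hm 0 le_rfl z := by
  refine (LipschitzWith.of_dist_le_mul (K := 1) fun z z' => ?_).continuous
  rw [dist_eq_norm, dist_eq_norm, NNReal.coe_one, one_mul]
  refine (BoundedContinuousFunction.norm_le (norm_nonneg _)).2 fun p => ?_
  have hω := omega_pos hm p
  rw [BoundedContinuousFunction.sub_apply, planeWave_apply, planeWave_apply, ← sub_div, norm_div,
    Complex.norm_real, Real.norm_of_nonneg hω.le, div_le_iff₀ hω, zero_mul, sub_zero, sub_zero]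
  have h1 : Complex.exp (Complex.I * (inner ℝ p z : ℝ)) -
      Complex.exp (Complex.I * (inner ℝ p z' : ℝ)) =
      Complex.exp (Complex.I * (inner ℝ p z' : ℝ)) *
        (Complex.exp (Complex.I * (inner ℝ p (z - z') : ℝ)) - 1) := by
    rw [mul_sub, ← Complex.exp_add, mul_one, inner_sub_right]
    congr 2
    push_cast; ring
  rw [h1, norm_mul, norm_cexp_I_mul_ofReal, one_mul]
  refine (Real.norm_exp_I_mul_ofReal_sub_one_le).trans ?_
  rw [mul_comm]
  refine (abs_real_inner_le_norm _ _).trans ?_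
  gcongr
  exact norm_le_omega m p

/-- From `1 - e^{-εω} ≤ εω`, division by `ω` leaves the bound `ε`, uniform in the momentum. The
truncation `max ε 0` keeps the time in the closed lower half-plane for every real `ε` and is
invisible for `ε > 0`. -/
theorem tendsto_planeWave {m : ℝ} (hm : 0 < m) (τ : ℝ) (z : E3) (h0 : ((τ : ℂ)).im ≤ 0)
    (hε : ∀ ε : ℝ, (((τ : ℂ) - (max ε 0 : ℝ) * Complex.I)).im ≤ 0) :
    Tendsto (fun ε : ℝ => planeWave hm (τ - (max ε 0 : ℝ) * Complex.I) (hε ε) z) (𝓝[>] 0)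
      (𝓝 (planeWave hm τ h0 z)) := by
  rw [tendsto_iff_norm_sub_tendsto_zero]
  refine squeeze_zero' (Eventually.of_forall fun _ => norm_nonneg _) (g := fun ε : ℝ => ε) ?_
    (tendsto_nhdsWithin_of_tendsto_nhds tendsto_id)
  filter_upwards [self_mem_nhdsWithin] with ε hpos
  have hpos : 0 < ε := hpos
  refine (BoundedContinuousFunction.norm_le hpos.le).2 fun p => ?_
  have hω := omega_pos hm p
  rw [BoundedContinuousFunction.sub_apply, planeWave_apply, planeWave_apply, ← sub_div, norm_div,
    Complex.norm_real, Real.norm_of_nonneg hω.le, div_le_iff₀ hω, max_eq_left hpos.le]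
  have h1 : Complex.exp (Complex.I * ((inner ℝ p z : ℝ) - (τ - ε * Complex.I) * omega m p)) -
      Complex.exp (Complex.I * ((inner ℝ p z : ℝ) - τ * omega m p)) =
      Complex.exp (Complex.I * ((inner ℝ p z : ℝ) - τ * omega m p)) *
        ((Real.exp (-(ε * omega m p)) - 1 : ℝ) : ℂ) := by
    push_cast
    rw [mul_sub (Complex.exp _), ← Complex.exp_add, mul_one]
    congr 2
    linear_combination (-(ε : ℂ) * omega m p) * (- Complex.I_mul_I)
  rw [h1, norm_mul, norm_cexp_sub_mul_omega, Complex.ofReal_im, zero_mul, Real.exp_zero, one_mul,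
    Complex.norm_real, Real.norm_eq_abs, abs_sub_comm]
  have h2 := Real.add_one_le_exp (-(ε * omega m p))
  have h3 : Real.exp (-(ε * omega m p)) ≤ 1 := Real.exp_le_one_iff.2 (by
    have := mul_pos hpos hω
    linarith)
  rw [abs_of_nonneg (by linarith)]
  linarith

theorem integrable_timeKernel_smul_planeWave {m : ℝ} (hm : 0 < m) {t : ℂ} (ht : t.im < 0)
    (w : E3) : Integrable fun z : E3 => timeKernel m t (w - z) • planeWave hm 0 le_rfl z := by
  refine (((integrable_timeKernel hm ht).comp_sub_left w).norm.mul_const m⁻¹).mono' ?_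
    (ae_of_all _ fun z => ?_)
  · exact (((continuous_timeKernel hm ht).comp (by fun_prop : Continuous fun z : E3 => w - z)).smul
      (continuous_planeWave hm)).aestronglyMeasurable
  · rw [norm_smul]
    exact mul_le_mul_of_nonneg_left (norm_planeWave_le hm 0 le_rfl z) (norm_nonneg _)

/-- Convolution with the time kernel evolves plane waves in time. -/
theorem integral_timeKernel_smul_planeWave {m : ℝ} (hm : 0 < m) {t : ℂ} (ht : t.im < 0)
    (w : E3) : ∫ z : E3, timeKernel m t (w - z) • planeWave hm 0 le_rfl z =
      planeWave hm t ht.le w := by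
  ext p
  -- Evaluation at a momentum is a continuous functional, so the Bochner integral can be computed
  -- pointwise in `p`. The substitution `z = w - v` then exposes the inverse Fourier transform of
  -- the kernel.
  have h1 := (BoundedContinuousFunction.evalCLM ℂ (α := E3) (β := ℂ) p).integral_comp_comm
    (integrable_timeKernel_smul_planeWave hm ht w)
  simp only [BoundedContinuousFunction.evalCLM_apply, BoundedContinuousFunction.smul_apply,
    planeWave_apply] at h1
  rw [← h1, planeWave_apply]
  have h2 := integral_sub_left_eq_self (fun z : E3 => timeKernel m t (w - z) •
    (Complex.exp (Complex.I * ((inner ℝ p z : ℝ) - 0 * omega m p)) / (omega m p : ℂ))) volume w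
  rw [← h2]
  have h3 : ∀ v : E3, timeKernel m t (w - (w - v)) •
      (Complex.exp (Complex.I * ((inner ℝ p (w - v) : ℝ) - 0 * omega m p)) / (omega m p : ℂ)) =
      Complex.exp (Complex.I * (inner ℝ p w : ℝ)) / (omega m p : ℂ) *
        (timeKernel m t v * Complex.exp (-(Complex.I * (inner ℝ p v : ℝ)))) := by
    intro v
    have h4 : Complex.exp (Complex.I * ((inner ℝ p (w - v) : ℝ) - 0 * omega m p)) =
        Complex.exp (Complex.I * (inner ℝ p w : ℝ)) *
          Complex.exp (-(Complex.I * (inner ℝ p v : ℝ))) := by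
      rw [← Complex.exp_add, inner_sub_right]
      congr 1
      push_cast; ring
    rw [sub_sub_cancel, smul_eq_mul, h4]; ring
  simp_rw [h3]
  rw [integral_const_mul, integral_timeKernel_mul_cexp hm ht, div_mul_eq_mul_div, ← Complex.exp_add]
  congr 2
  ring

/-- The momentum weight relating `planeWave` to the coefficient functions of `phi1`. -/
def planeWaveWeight (m : ℝ) (p : E3) : ℂ :=
  (((2 * π) ^ (-(3 / 2) : ℝ) : ℝ) : ℂ) * (√(2 * omega m p) : ℝ) * (omega m p : ℂ)

theorem continuous_planeWaveWeight (m : ℝ) : Continuous (planeWaveWeight m) := by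
  unfold planeWaveWeight
  have hω := continuous_omega m
  fun_prop

/-- The true growth is of order `‖p‖^{3/2}`; the quadratic bound is the form required by
`exists_contraction`. -/
theorem norm_planeWaveWeight_le {m : ℝ} (hm : 0 < m) (p : E3) :
    ‖planeWaveWeight m p‖ ≤
      ((2 * π) ^ (-(3 / 2) : ℝ) * ((2 * (1 + m) + 1) * (1 + m))) * (1 + ‖p‖) ^ 2 := by
  have hω := omega_pos hm p
  unfold planeWaveWeight
  rw [norm_mul, norm_mul, Complex.norm_real, Complex.norm_real, Complex.norm_real,
    Real.norm_of_nonneg (by positivity), Real.norm_of_nonneg (by positivity),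
    Real.norm_of_nonneg hω.le]
  have h1 := omega_le hm p
  have h2 : √(2 * omega m p) ≤ (2 * (1 + m) + 1) * (1 + ‖p‖) := by
    refine Real.sqrt_le_iff.2 ⟨by positivity, ?_⟩
    have h3 : 1 ≤ (2 * (1 + m) + 1) * (1 + ‖p‖) := by
      nlinarith [norm_nonneg p, mul_nonneg hm.le (norm_nonneg p)]
    nlinarith [norm_nonneg p]
  calc (2 * π) ^ (-(3 / 2) : ℝ) * √(2 * omega m p) * omega m p
      ≤ (2 * π) ^ (-(3 / 2) : ℝ) * ((2 * (1 + m) + 1) * (1 + ‖p‖)) *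
        ((1 + m) * (1 + ‖p‖)) := by gcongr
    _ = _ := by ring

theorem planeWave_mul_weight {m : ℝ} (hm : 0 < m) (x : SpaceTime) (h : ((x.1 : ℂ)).im ≤ 0) :
    (fun p => planeWave hm x.1 h x.2 p * planeWaveWeight m p) =
      fun p => (starRingEnd ℂ) (localizedWave m x p) := by
  ext p
  have hω : (omega m p : ℂ) ≠ 0 := Complex.ofReal_ne_zero.2 (omega_pos hm p).ne'
  rw [conj_localizedWave, planeWave_apply, planeWaveWeight]
  have h1 : Complex.I * ((inner ℝ p x.2 : ℝ) - (x.1 : ℂ) * omega m p) =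
      -(Complex.I * (shellDot m p x : ℝ)) := by
    unfold shellDot
    push_cast; ring
  rw [h1]
  field_simp

/-- On a vector of the Schwartz core, `φ₁` factors through the plane waves. -/
theorem exists_phi1_clm {m : ℝ} (hm : 0 < m) {Ψ : Fock m} (hΨ : Ψ ∈ schwartzCore m) :
    ∃ T : BoundedContinuousFunction E3 ℂ →L[ℂ] Fock m,
      ∀ (x : SpaceTime) (h : ((x.1 : ℂ)).im ≤ 0),
        (Ψ, T (planeWave hm x.1 h x.2)) ∈ (phi1 m x).graph := by
  obtain ⟨T, hT⟩ := exists_annihilation_clm hm (continuous_planeWaveWeight m)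
    (norm_planeWaveWeight_le hm) hΨ
  refine ⟨T, fun x h => ?_⟩
  unfold phi1
  rw [annihilation_graph, ← planeWave_mul_weight hm x h]
  exact hT _

theorem apply_eq_of_mem_graph {m : ℝ} {A : Fock m →ₗ.[ℂ] Fock m} {Ψ Φ : Fock m}
    (h : (Ψ, Φ) ∈ A.graph) (hΨ : Ψ ∈ A.domain) : A ⟨Ψ, hΨ⟩ = Φ :=
  A.mem_graph_snd_inj (A.mem_graph ⟨Ψ, hΨ⟩) h rfl

theorem schwartzCore_subset_domain_phi1 {m : ℝ} (hm : 0 < m) (x : SpaceTime) :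
    schwartzCore m ⊆ (phi1 m x).domain := by
  intro Ψ hΨ
  obtain ⟨T, hT⟩ := exists_phi1_clm hm hΨ
  exact LinearPMap.mem_domain_of_mem_graph (hT x (by simp))

/-- Time evolution of `ã` as a convolution with the time kernel. -/
theorem conjugate_aTilde_eq_lim {m : ℝ} (hm : 0 < m) (y : SpaceTime)
    (R : Matrix.specialOrthogonalGroup (Fin 3) ℝ) (x : E3) {Ψ : Fock m}
    (hΨ : Ψ ∈ schwartzCore m) :
    ∃ (hU : Ψ ∈ (conjugate (U m y R) (aTilde m x)).domain)
      (hz : ∀ z : E3, Ψ ∈ (aTilde m z).domain),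
      (∀ ε : ℝ, 0 < ε → Integrable (fun z : E3 =>
        timeKernel m (y.1 - ε * Complex.I) (rot R x + y.2 - z) • aTilde m z ⟨Ψ, hz z⟩)) ∧
      Tendsto (fun ε : ℝ => ∫ z : E3,
        timeKernel m (y.1 - ε * Complex.I) (rot R x + y.2 - z) • aTilde m z ⟨Ψ, hz z⟩) (𝓝[>] 0)
        (𝓝 (conjugate (U m y R) (aTilde m x) ⟨Ψ, hU⟩)) := by
  obtain ⟨T, hT⟩ := exists_phi1_clm hm hΨ
  have hgz : ∀ z : E3, (Ψ, T (planeWave hm 0 le_rfl z)) ∈ (aTilde m z).graph := by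
    intro z
    rw [aTilde_eq_phi1 hm]
    simpa using hT (0, z) (by simp)
  -- By covariance the conjugated operator is `φ₁(y⁰, R𝐱 + 𝐲)`. Both sides of the formula are
  -- therefore values of the same map `T` on plane waves, at times `y⁰` and 0.
  have hgU : (Ψ, T (planeWave hm y.1 (by simp) (rot R x + y.2))) ∈
      (conjugate (U m y R) (aTilde m x)).graph := by
    rw [aTilde_eq_phi1 hm, conjugate_phi1]
    simpa using hT (0 + y.1, rot R x + y.2) (by simp)
  refine ⟨LinearPMap.mem_domain_of_mem_graph hgU,
    fun z => LinearPMap.mem_domain_of_mem_graph (hgz z), ?_⟩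
  have hval : ∀ z, aTilde m z ⟨Ψ, LinearPMap.mem_domain_of_mem_graph (hgz z)⟩ =
      T (planeWave hm 0 le_rfl z) := fun z => apply_eq_of_mem_graph (hgz z) _
  have him : ∀ ε : ℝ, 0 < ε → ((y.1 : ℂ) - ε * Complex.I).im < 0 := fun ε hε => by simpa using hε
  have hfun : ∀ ε : ℝ, (fun z : E3 => timeKernel m (y.1 - ε * Complex.I) (rot R x + y.2 - z) •
      aTilde m z ⟨Ψ, LinearPMap.mem_domain_of_mem_graph (hgz z)⟩) = fun z : E3 =>
      T (timeKernel m (y.1 - ε * Complex.I) (rot R x + y.2 - z) • planeWave hm 0 le_rfl z) := by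
    intro ε
    ext1 z
    rw [hval, map_smul]
  refine ⟨fun ε hε => ?_, ?_⟩
  · rw [hfun]
    exact T.integrable_comp (integrable_timeKernel_smul_planeWave hm (him ε hε) _)
  · rw [apply_eq_of_mem_graph hgU]
    have hle : ∀ ε : ℝ, ((y.1 : ℂ) - (max ε 0 : ℝ) * Complex.I).im ≤ 0 := fun ε => by simp
    have hlim := (T.continuous.tendsto _).comp
      (tendsto_planeWave hm y.1 (rot R x + y.2) (by simp) hle)
    refine hlim.congr' ?_
    filter_upwards [self_mem_nhdsWithin] with ε hε
    have hε : 0 < ε := hε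
    -- Once `T` is pulled out of the integral, the convolution is the plane wave at time `y⁰ - iε`,
    -- whose limit is already known.
    rw [hfun, T.integral_comp_comm (integrable_timeKernel_smul_planeWave hm (him ε hε) _),
      integral_timeKernel_smul_planeWave hm (him ε hε)]
    simp only [Function.comp_apply, max_eq_left hε.le]

end ScalarField

end

theorem mainTheorem3 (m : ℝ) (hm : 0 < m) (y : ScalarField.SpaceTime)
    (R : Matrix.specialOrthogonalGroup (Fin 3) ℝ) :
    -- covariance of `φ₁`, an equality of densely defined operators with their domains
    (∀ x : ScalarField.SpaceTime,
      ScalarField.schwartzCore m ⊆ (ScalarField.phi1 m x).domain ∧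
      ScalarField.conjugate (ScalarField.U m y R) (ScalarField.phi1 m x) =
        ScalarField.phi1 m (x.1 + y.1, ScalarField.rot R x.2 + y.2)) ∧
    -- the convolution formula for `ã`, with `y⁰` approached from the lower half-plane
    (∀ (x : ScalarField.E3), ∀ Ψ ∈ ScalarField.schwartzCore m,
      ∃ (hU : Ψ ∈ (ScalarField.conjugate (ScalarField.U m y R) (ScalarField.aTilde m x)).domain)
        (hz : ∀ z : ScalarField.E3, Ψ ∈ (ScalarField.aTilde m z).domain),
        (∀ ε : ℝ, 0 < ε → Integrable (fun z : ScalarField.E3 =>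
          ScalarField.timeKernel m (y.1 - ε * Complex.I) (ScalarField.rot R x + y.2 - z) •
            ScalarField.aTilde m z ⟨Ψ, hz z⟩)) ∧
        Tendsto (fun ε : ℝ => ∫ z : ScalarField.E3,
          ScalarField.timeKernel m (y.1 - ε * Complex.I) (ScalarField.rot R x + y.2 - z) •
            ScalarField.aTilde m z ⟨Ψ, hz z⟩) (𝓝[>] 0)
          (𝓝 (ScalarField.conjugate (ScalarField.U m y R) (ScalarField.aTilde m x) ⟨Ψ, hU⟩))) ∧
    -- in the space-like region the limiting kernel is the displayed function at real time `y⁰`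
    TendstoLocallyUniformlyOn
      (fun (ε : ℝ) (v : ScalarField.E3) => ScalarField.timeKernel m (y.1 - ε * Complex.I) v)
      (fun v => ScalarField.timeKernel m y.1 v) (𝓝[>] 0) {v | |y.1| < ‖v‖} := by
  exact ⟨fun x => ⟨ScalarField.schwartzCore_subset_domain_phi1 hm x,
      ScalarField.conjugate_phi1 m y R x⟩,
    fun x Ψ hΨ => ScalarField.conjugate_aTilde_eq_lim hm y R x hΨ,
    ScalarField.tendstoLocallyUniformlyOn_timeKernel hm y.1⟩
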